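/- Let $\mathbb K=\mathbb R$ or $\mathbb C$, let $\Omega\subseteq\mathbb R^m$ be open, and let $(\Omega_l)_{l\in\mathbb N}$ be any exhaustive sequence of open subsets of $\Omega$ (each $\overline{\Omega_l}$ is compact, $\overline{\Omega_l}\subset\Omega_{l+1}$, $\bigcup_l\Omega_l=\Omega$). Then the full Colombeau algebra $\mathcal G(\Omega)$, endowed with its topology $\mathcal T_\Omega$, is complete (as a topological additive group). Here the notions are as follows. For $\varphi\in\mathcal D(\mathbb R^m;\mathbb K)$ and $\varepsilon>0$ put $\varphi_\varepsilon(x)=\varepsilon^{-m}\varphi(x/\varepsilon)$ and $i(\varphi)=\operatorname{diam}\operatorname{supp}\varphi$. The sets $\mathcal A_0\supseteq\mathcal A_1\supseteq\cdots$ are given by either of the two usual choices, and the statement holds for both: (1) $\mathcal A_q$ is the set of $\varphi\in\mathcal D(\mathbb R^m;\mathbb K)$ with $\int\varphi=1$ and $\int x^\alpha\varphi(x)\,dx=0$ for all $\alpha\in\mathbb N^m$ with $1\le|\alpha|\le q$; (2) $\mathcal A_q$ is the set of $\varphi\in\mathcal D(\mathbb R^m;\mathbb K)$ that depend only on $|x|$,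 are constant near $0$, and satisfy $\int\varphi=1$ and $\int|x|^{mj/l}\varphi(x)\,dx=0$ for all $1\le j,l\le q$. Let $\Gamma$ be the set of strictly increasing sequences $\gamma:\mathbb N\to[0,\infty)$ with $\gamma(q)\to\infty$. A function $a:\mathcal A_0\to\mathbb R$ is *moderate* if there is $N\in\mathbb N$ such that for every $\varphi\in\mathcal A_N$ there are $c>0$, $\eta\in(0,1]$ with $|a(\varphi_\varepsilon)|\le c\,\varepsilon^{-N}$ for $0<\varepsilon<\eta$. It is *negligible* if there are $N\in\mathbb N$ and $\gamma\in\Gamma$ such that for all $q\ge N$ and $\varphi\in\mathcal A_q$ there are $c>0$, $\eta\in(0,1]$ with $|a(\varphi_\varepsilon)|\le c\,\varepsilon^{\gamma(q)-N}$ for $0<\varepsilon<\eta$. Let $\overline{\mathbb R}$ be the ring of moderate functions modulo the ideal of negligible ones. For $x,y\in\overline{\mathbb R}$, $x\le y$ means that $y-x$ has a representative that is $\ge 0$ on all of $\mathcal A_0$. Let $\alpha_r^\bullet\in\overline{\mathbb R}$ be the class of $\varphi\mapsto i(\varphi)^r$. $\mathcal E_M[\Omega]$ is the algebra of all $u:\mathcal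 A_0\times\Omega\to\mathbb K$ such that every $u(\varphi,\cdot)$ is $C^\infty$ and, for every compact $K\subset\Omega$ and every $\sigma\in\mathbb N^m$, the function $\varphi\mapsto\sup_{x\in K}|\partial^\sigma u(\varphi,x)|$ is moderate. $\mathcal N[\Omega]$ is the ideal of those $u\in\mathcal E_M[\Omega]$ for which all these functions are negligible, and $\mathcal G(\Omega)=\mathcal E_M[\Omega]/\mathcal N[\Omega]$. For $f\in\mathcal G(\Omega)$ with representative $u$ let $\|f\|_{l,\sigma}\in\overline{\mathbb R}$ be the class of $\varphi\mapsto\sup_{x\in\overline{\Omega_l}}|\partial^\sigma u(\varphi,x)|$. The topology $\mathcal T_\Omega$ is the translation-invariant topology on $\mathcal G(\Omega)$ for which the sets $$W^\sigma_{l,r}=\{f\in\mathcal G(\Omega):\ \|f\|_{l,\kappa}\le\alpha_r^\bullet\ \text{ for all }\kappa\le\sigma\}\qquad(l\in\mathbb N,\ \sigma\in\mathbb N^m,\ r\in\mathbb N,\ r\ge1)$$ form a fundamental system of neighbourhoods of $0$. -/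

import Mathlib

open scoped ContDiff Pointwise
open Filter Set

noncomputable section

namespace Colombeau

/-- The Euclidean space `ℝ^m`. -/
abbrev E (m : ℕ) : Type := EuclideanSpace ℝ (Fin m)

/-! ### Partial derivatives -/

/-- The partial derivative `∂_i f`. -/
def pderiv {𝕜 : Type*} [RCLike 𝕜] {m : ℕ} (i : Fin m) (f : E m → 𝕜) : E m → 𝕜 :=
  fun x => fderiv ℝ f x (EuclideanSpace.single i 1)

/-- Iterated partial derivatives along a list of coordinates, with multiplicities `σ`. -/
def listDeriv {𝕜 : Type*} [RCLike 𝕜] {m : ℕ} (L : List (Fin m)) (σ : Fin m → ℕ)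
    (f : E m → 𝕜) : E m → 𝕜 :=
  L.foldr (fun i g => (pderiv i)^[σ i] g) f

/-- `∂^σ f = ∂_1^{σ_1} ⋯ ∂_m^{σ_m} f` for a multi-index `σ ∈ ℕ^m`. -/
def multiDeriv {𝕜 : Type*} [RCLike 𝕜] {m : ℕ} (σ : Fin m → ℕ) (f : E m → 𝕜) : E m → 𝕜 :=
  listDeriv (List.finRange m) σ f

/-- `‖f‖_K = sup {|f x| : x ∈ K}` (equal to `0` for empty `K`). It is only used for functions that
are continuous on the compact set `K`. -/
def supNorm {𝕜 : Type*} [RCLike 𝕜] {m : ℕ} (K : Set (E m)) (f : E m → 𝕜) : ℝ :=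
  ⨆ x : K, ‖f x‖

/-! ### Test functions -/

/-- `φ_ε(x) = ε^{-m} φ(x / ε)`. -/
def scaleFun {𝕜 : Type*} [RCLike 𝕜] {m : ℕ} (ε : ℝ) (φ : E m → 𝕜) : E m → 𝕜 :=
  fun x => (ε ^ m)⁻¹ • φ (ε⁻¹ • x)

/-- `i(φ)`, the diameter of the support of `φ`. -/
def suppDiam {𝕜 : Type*} [RCLike 𝕜] {m : ℕ} (φ : E m → 𝕜) : ℝ := Metric.diam (tsupport φ)

/-- A decreasing sequence `𝒜_0 ⊇ 𝒜_1 ⊇ …` of sets of test functions in `𝒟(ℝ^m; 𝕜)`, each closed under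
`φ ↦ φ_ε`, `ε > 0`. It only serves to treat `momentFamily` and `radialFamily` below together. -/
structure TestFamily (𝕜 : Type*) [RCLike 𝕜] (m : ℕ) where
  sets : ℕ → Set (E m → 𝕜)
  anti : Antitone sets
  smooth : ∀ φ ∈ sets 0, ContDiff ℝ ∞ φ
  compact : ∀ φ ∈ sets 0, HasCompactSupport φ
  scale_mem : ∀ q, ∀ φ ∈ sets q, ∀ ε : ℝ, 0 < ε → scaleFun ε φ ∈ sets q

/-- The index set `𝒜_0`. -/
abbrev TestFamily.Idx {𝕜 : Type*} [RCLike 𝕜] {m : ℕ} (A : TestFamily 𝕜 m) : Type _ :=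
  ↥(A.sets 0)

/-- The map `φ ↦ φ_ε` on `𝒜_0`. -/
def TestFamily.scale {𝕜 : Type*} [RCLike 𝕜] {m : ℕ} (A : TestFamily 𝕜 m)
    (ε : ℝ) (hε : 0 < ε) (φ : A.Idx) : A.Idx :=
  ⟨scaleFun ε φ.1, A.scale_mem 0 φ.1 φ.2 ε hε⟩

section ScaleLemmas

variable {𝕜 : Type*} [RCLike 𝕜] {m : ℕ}

theorem contDiff_scaleFun (ε : ℝ) {φ : E m → 𝕜} (h : ContDiff ℝ ∞ φ) :
    ContDiff ℝ ∞ (scaleFun ε φ) := by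
  unfold scaleFun
  exact (h.comp (contDiff_const_smul _)).const_smul _

theorem tsupport_scaleFun {ε : ℝ} (hε : 0 < ε) (φ : E m → 𝕜) :
    tsupport (scaleFun ε φ) = ε • tsupport φ := by
  have h : Function.support (scaleFun ε φ) = ε • Function.support φ := by
    ext x
    rw [Set.mem_smul_set_iff_inv_smul_mem₀ hε.ne']
    simp [scaleFun, Function.mem_support, hε.ne']
  rw [tsupport, h, tsupport, ← closure_smul₀' hε.ne']

theorem hasCompactSupport_scaleFun {ε : ℝ} (hε : 0 < ε) {φ : E m → 𝕜}
    (h : HasCompactSupport φ) : HasCompactSupport (scaleFun ε φ) := by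
  unfold HasCompactSupport
  rw [tsupport_scaleFun hε]
  exact IsCompact.smul ε h

theorem suppDiam_scaleFun {ε : ℝ} (hε : 0 < ε) (φ : E m → 𝕜) :
    suppDiam (scaleFun ε φ) = ε * suppDiam φ := by
  unfold suppDiam
  rw [tsupport_scaleFun hε, diam_smul₀, Real.norm_of_nonneg hε.le]

/-- Change of variables for a positively homogeneous weight. -/
theorem integral_scaleFun {ε : ℝ} (hε : 0 < ε) (φ : E m → 𝕜) (w : E m → ℝ) (c : ℝ)
    (hw : ∀ x, w (ε • x) = c * w x) :
    ∫ x, w x • scaleFun ε φ x = c • ∫ x, w x • φ x := by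
  have h := MeasureTheory.Measure.integral_comp_smul (MeasureTheory.volume : MeasureTheory.Measure (E m))
    (fun x => w (ε • x) • φ x) ε⁻¹
  have e1 : (fun x => w x • scaleFun ε φ x)
      = fun x => (ε ^ m)⁻¹ • (w (ε • ε⁻¹ • x) • φ (ε⁻¹ • x)) := by
    funext x
    rw [smul_inv_smul₀ hε.ne', scaleFun, smul_comm]
  rw [e1, MeasureTheory.integral_smul, h]
  simp only [hw, mul_smul, finrank_euclideanSpace, Fintype.card_fin]
  rw [MeasureTheory.integral_smul, smul_smul, smul_smul]
  congr 1
  have : (0 : ℝ) < ε ^ m := pow_pos hε m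
  rw [inv_pow, inv_inv, abs_of_pos this, inv_mul_cancel₀ this.ne', one_mul]

end ScaleLemmas

/-- The sets `𝒜_q` given by moment conditions:
`φ ∈ 𝒟(ℝ^m; 𝕜)`, `∫ φ = 1` and `∫ x^α φ(x) dx = 0` for all `α ∈ ℕ^m` with `1 ≤ |α| ≤ q`. -/
def momentSet (𝕜 : Type*) [RCLike 𝕜] (m : ℕ) (q : ℕ) : Set (E m → 𝕜) :=
  {φ | ContDiff ℝ ∞ φ ∧ HasCompactSupport φ ∧ ∫ x, φ x = 1 ∧
    ∀ α : Fin m → ℕ, 1 ≤ ∑ i, α i → ∑ i, α i ≤ q → ∫ x, (∏ i, x i ^ α i) • φ x = 0}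

/-- The sets `𝒜_q` of radial test functions:
`φ ∈ 𝒟(ℝ^m; 𝕜)` depends only on `|x|` and is constant near `0`, `∫ φ = 1` and
`∫ |x|^{m j / l} φ(x) dx = 0` for all `1 ≤ j, l ≤ q`. For `m = 1` these are the even `φ`, constant
near `0`, with `∫_0^∞ φ = 1/2` and `∫_0^∞ x^{j/l} φ(x) dx = 0`; those for general `m` are the
functions `x ↦ C φ(|x|^m)`, with `C` a normalizing constant and `φ` in the set for `m = 1`. -/
def radialSet (𝕜 : Type*) [RCLike 𝕜] (m : ℕ) (q : ℕ) : Set (E m → 𝕜) :=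
  {φ | ContDiff ℝ ∞ φ ∧ HasCompactSupport φ ∧ (∀ x y, ‖x‖ = ‖y‖ → φ x = φ y) ∧
    (∃ δ > 0, ∀ x, ‖x‖ < δ → φ x = φ 0) ∧ ∫ x, φ x = 1 ∧
    ∀ j l : ℕ, 1 ≤ j → j ≤ q → 1 ≤ l → l ≤ q →
      ∫ x, (‖x‖ ^ ((m * j : ℝ) / l)) • φ x = 0}

theorem integral_scaleFun_one {𝕜 : Type*} [RCLike 𝕜] {m : ℕ} {ε : ℝ} (hε : 0 < ε)
    (φ : E m → 𝕜) : ∫ x, scaleFun ε φ x = ∫ x, φ x := by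
  simpa using integral_scaleFun hε φ (fun _ => 1) 1 (by simp)

/-- The family of the sets `momentSet`. -/
def momentFamily (𝕜 : Type*) [RCLike 𝕜] (m : ℕ) : TestFamily 𝕜 m where
  sets := momentSet 𝕜 m
  anti := fun _ _ h _ hφ => ⟨hφ.1, hφ.2.1, hφ.2.2.1, fun α h1 h2 => hφ.2.2.2 α h1 (h2.trans h)⟩
  smooth := fun _ h => h.1
  compact := fun _ h => h.2.1
  scale_mem := by
    rintro q φ ⟨h1, h2, h3, h4⟩ ε hε
    refine ⟨contDiff_scaleFun ε h1, hasCompactSupport_scaleFun hε h2, ?_, fun α ha hb => ?_⟩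
    · rw [integral_scaleFun_one hε, h3]
    · rw [integral_scaleFun hε φ (fun x => ∏ i, x i ^ α i) (∏ i, ε ^ α i), h4 α ha hb, smul_zero]
      intro x
      simp [mul_pow, Finset.prod_mul_distrib]

/-- The family of the sets `radialSet`. -/
def radialFamily (𝕜 : Type*) [RCLike 𝕜] (m : ℕ) : TestFamily 𝕜 m where
  sets := radialSet 𝕜 m
  anti := fun _ _ h _ hφ => ⟨hφ.1, hφ.2.1, hφ.2.2.1, hφ.2.2.2.1, hφ.2.2.2.2.1,
    fun j l h1 h2 h3 h4 => hφ.2.2.2.2.2 j l h1 (h2.trans h) h3 (h4.trans h)⟩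
  smooth := fun _ h => h.1
  compact := fun _ h => h.2.1
  scale_mem := by
    rintro q φ ⟨h1, h2, h3, ⟨δ, hδ, h4⟩, h5, h6⟩ ε hε
    refine ⟨contDiff_scaleFun ε h1, hasCompactSupport_scaleFun hε h2, fun x y hxy => ?_,
      ⟨ε * δ, mul_pos hε hδ, fun x hx => ?_⟩, ?_, fun j l hj1 hj2 hl1 hl2 => ?_⟩
    · simp only [scaleFun]
      rw [h3 (ε⁻¹ • x) (ε⁻¹ • y) (by rw [norm_smul, norm_smul, hxy])]
    · simp only [scaleFun, smul_zero]
      rw [h4]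
      rw [norm_smul, Real.norm_of_nonneg (inv_nonneg.2 hε.le), inv_mul_lt_iff₀ hε]
      exact hx
    · rw [integral_scaleFun_one hε, h5]
    · rw [integral_scaleFun hε φ (fun x => ‖x‖ ^ ((m * j : ℝ) / l)) (ε ^ ((m * j : ℝ) / l)),
        h6 j l hj1 hj2 hl1 hl2, smul_zero]
      intro x
      rw [norm_smul, Real.norm_of_nonneg hε.le, Real.mul_rpow hε.le (norm_nonneg x)]

/-! ### Moderate and negligible functions on `𝒜_0`, generalized real numbers -/

section Numbers

variable {𝕜 : Type*} [RCLike 𝕜] {m : ℕ}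

/-- `a : 𝒜_0 → ℝ` is moderate: there is `N` such that for all `φ ∈ 𝒜_N` there are `c > 0` and
`η ∈ ]0,1]` with `|a(φ_ε)| ≤ c ε^{-N}` for `0 < ε < η`. -/
def IsModerate (A : TestFamily 𝕜 m) (a : A.Idx → ℝ) : Prop :=
  ∃ N : ℕ, ∀ φ : A.Idx, φ.1 ∈ A.sets N → ∃ c : ℝ, 0 < c ∧ ∃ η : ℝ, 0 < η ∧ η ≤ 1 ∧
    ∀ (ε : ℝ) (hε : 0 < ε), ε < η → |a (A.scale ε hε φ)| ≤ c * ε ^ (-(N : ℝ))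

/-- The set `Γ` of strictly increasing sequences `γ : ℕ → [0,∞[` diverging to infinity. -/
def IsGauge (γ : ℕ → ℝ) : Prop := StrictMono γ ∧ (∀ q, 0 ≤ γ q) ∧ Tendsto γ atTop atTop

/-- `a : 𝒜_0 → ℝ` is negligible: there are `N` and `γ ∈ Γ` such that for all `q ≥ N` and `φ ∈ 𝒜_q`
there are `c > 0` and `η ∈ ]0,1]` with `|a(φ_ε)| ≤ c ε^{γ(q)-N}` for `0 < ε < η`. -/
def IsNegligible (A : TestFamily 𝕜 m) (a : A.Idx → ℝ) : Prop :=
  ∃ (N : ℕ) (γ : ℕ → ℝ), IsGauge γ ∧ ∀ q : ℕ, N ≤ q → ∀ φ : A.Idx, φ.1 ∈ A.sets q →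
    ∃ c : ℝ, 0 < c ∧ ∃ η : ℝ, 0 < η ∧ η ≤ 1 ∧
      ∀ (ε : ℝ) (hε : 0 < ε), ε < η → |a (A.scale ε hε φ)| ≤ c * ε ^ (γ q - N)

theorem isGauge_cast : IsGauge (fun n : ℕ => (n : ℝ)) :=
  ⟨Nat.strictMono_cast, fun q => q.cast_nonneg, tendsto_natCast_atTop_atTop⟩

theorem IsGauge.min {γ δ : ℕ → ℝ} (h : IsGauge γ) (h' : IsGauge δ) :
    IsGauge (fun q => Min.min (γ q) (δ q)) :=
  ⟨fun _ _ hab => lt_min ((min_le_left _ _).trans_lt (h.1 hab))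
      ((min_le_right _ _).trans_lt (h'.1 hab)),
    fun q => le_min (h.2.1 q) (h'.2.1 q),
    tendsto_atTop.2 fun b => by
      filter_upwards [tendsto_atTop.1 h.2.2 b, tendsto_atTop.1 h'.2.2 b] with q h1 h2
      exact le_min h1 h2⟩

variable {A : TestFamily 𝕜 m} {a b c : A.Idx → ℝ}

theorem IsModerate.mono (h : IsModerate A b) (hab : ∀ φ, |a φ| ≤ |b φ|) : IsModerate A a := by
  obtain ⟨N, h⟩ := h
  refine ⟨N, fun φ hφ => ?_⟩
  obtain ⟨c, hc, η, h0, h1, h⟩ := h φ hφ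
  exact ⟨c, hc, η, h0, h1, fun ε hε hlt => (hab _).trans (h ε hε hlt)⟩

theorem IsNegligible.mono (h : IsNegligible A b) (hab : ∀ φ, |a φ| ≤ |b φ|) :
    IsNegligible A a := by
  obtain ⟨N, γ, hγ, h⟩ := h
  refine ⟨N, γ, hγ, fun q hq φ hφ => ?_⟩
  obtain ⟨c, hc, η, h0, h1, h⟩ := h q hq φ hφ
  exact ⟨c, hc, η, h0, h1, fun ε hε hlt => (hab _).trans (h ε hε hlt)⟩

theorem IsModerate.add (ha : IsModerate A a) (hb : IsModerate A b) :
    IsModerate A (fun φ => a φ + b φ) := by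
  obtain ⟨N, ha⟩ := ha
  obtain ⟨M, hb⟩ := hb
  refine ⟨max N M, fun φ hφ => ?_⟩
  obtain ⟨c, hc, η, h0, h1, ha⟩ := ha φ (A.anti (le_max_left N M) hφ)
  obtain ⟨d, hd, θ, k0, k1, hb⟩ := hb φ (A.anti (le_max_right N M) hφ)
  refine ⟨c + d, add_pos hc hd, min η θ, lt_min h0 k0, (min_le_left _ _).trans h1,
    fun ε hε hlt => ?_⟩
  have hε1 : ε ≤ 1 := (hlt.le.trans (min_le_left _ _)).trans h1
  have e1 : ε ^ (-(N : ℝ)) ≤ ε ^ (-((max N M : ℕ) : ℝ)) :=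
    Real.rpow_le_rpow_of_exponent_ge hε hε1 (neg_le_neg (Nat.cast_le.2 (le_max_left N M)))
  have e2 : ε ^ (-(M : ℝ)) ≤ ε ^ (-((max N M : ℕ) : ℝ)) :=
    Real.rpow_le_rpow_of_exponent_ge hε hε1 (neg_le_neg (Nat.cast_le.2 (le_max_right N M)))
  calc |a _ + b _| ≤ |a _| + |b _| := abs_add_le _ _
    _ ≤ c * ε ^ (-(N : ℝ)) + d * ε ^ (-(M : ℝ)) :=
        add_le_add (ha ε hε (hlt.trans_le (min_le_left _ _)))
          (hb ε hε (hlt.trans_le (min_le_right _ _)))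
    _ ≤ c * ε ^ (-((max N M : ℕ) : ℝ)) + d * ε ^ (-((max N M : ℕ) : ℝ)) :=
        add_le_add (mul_le_mul_of_nonneg_left e1 hc.le) (mul_le_mul_of_nonneg_left e2 hd.le)
    _ = _ := by ring

theorem IsNegligible.add (ha : IsNegligible A a) (hb : IsNegligible A b) :
    IsNegligible A (fun φ => a φ + b φ) := by
  obtain ⟨N, γ, hγ, ha⟩ := ha
  obtain ⟨M, δ, hδ, hb⟩ := hb
  refine ⟨max N M, _, hγ.min hδ, fun q hq φ hφ => ?_⟩
  obtain ⟨c, hc, η, h0, h1, ha⟩ := ha q ((le_max_left N M).trans hq) φ hφ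
  obtain ⟨d, hd, θ, k0, k1, hb⟩ := hb q ((le_max_right N M).trans hq) φ hφ
  refine ⟨c + d, add_pos hc hd, min η θ, lt_min h0 k0, (min_le_left _ _).trans h1,
    fun ε hε hlt => ?_⟩
  have hε1 : ε ≤ 1 := (hlt.le.trans (min_le_left _ _)).trans h1
  have e1 : ε ^ (γ q - N) ≤ ε ^ (min (γ q) (δ q) - ((max N M : ℕ) : ℝ)) :=
    Real.rpow_le_rpow_of_exponent_ge hε hε1
      (sub_le_sub (min_le_left _ _) (Nat.cast_le.2 (le_max_left N M)))
  have e2 : ε ^ (δ q - M) ≤ ε ^ (min (γ q) (δ q) - ((max N M : ℕ) : ℝ)) :=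
    Real.rpow_le_rpow_of_exponent_ge hε hε1
      (sub_le_sub (min_le_right _ _) (Nat.cast_le.2 (le_max_right N M)))
  calc |a _ + b _| ≤ |a _| + |b _| := abs_add_le _ _
    _ ≤ c * ε ^ (γ q - N) + d * ε ^ (δ q - M) :=
        add_le_add (ha ε hε (hlt.trans_le (min_le_left _ _)))
          (hb ε hε (hlt.trans_le (min_le_right _ _)))
    _ ≤ c * ε ^ (min (γ q) (δ q) - ((max N M : ℕ) : ℝ))
          + d * ε ^ (min (γ q) (δ q) - ((max N M : ℕ) : ℝ)) :=
        add_le_add (mul_le_mul_of_nonneg_left e1 hc.le) (mul_le_mul_of_nonneg_left e2 hd.le)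
    _ = _ := by ring

theorem IsModerate.mul (ha : IsModerate A a) (hb : IsModerate A b) :
    IsModerate A (fun φ => a φ * b φ) := by
  obtain ⟨N, ha⟩ := ha
  obtain ⟨M, hb⟩ := hb
  refine ⟨N + M, fun φ hφ => ?_⟩
  obtain ⟨c, hc, η, h0, h1, ha⟩ := ha φ (A.anti (Nat.le_add_right N M) hφ)
  obtain ⟨d, hd, θ, k0, k1, hb⟩ := hb φ (A.anti (Nat.le_add_left M N) hφ)
  refine ⟨c * d, mul_pos hc hd, min η θ, lt_min h0 k0, (min_le_left _ _).trans h1,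
    fun ε hε hlt => ?_⟩
  rw [abs_mul]
  calc |a _| * |b _| ≤ (c * ε ^ (-(N : ℝ))) * (d * ε ^ (-(M : ℝ))) :=
        mul_le_mul (ha ε hε (hlt.trans_le (min_le_left _ _)))
          (hb ε hε (hlt.trans_le (min_le_right _ _))) (abs_nonneg _) (by positivity)
    _ = c * d * (ε ^ (-(N : ℝ)) * ε ^ (-(M : ℝ))) := by ring
    _ = _ := by rw [← Real.rpow_add hε]; push_cast; ring_nf

theorem IsModerate.mul_negligible (ha : IsModerate A a) (hb : IsNegligible A b) :
    IsNegligible A (fun φ => a φ * b φ) := by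
  obtain ⟨N, ha⟩ := ha
  obtain ⟨M, δ, hδ, hb⟩ := hb
  refine ⟨N + M, δ, hδ, fun q hq φ hφ => ?_⟩
  obtain ⟨c, hc, η, h0, h1, ha⟩ := ha φ (A.anti ((Nat.le_add_right N M).trans hq) hφ)
  obtain ⟨d, hd, θ, k0, k1, hb⟩ := hb q ((Nat.le_add_left M N).trans hq) φ hφ
  refine ⟨c * d, mul_pos hc hd, min η θ, lt_min h0 k0, (min_le_left _ _).trans h1,
    fun ε hε hlt => ?_⟩
  rw [abs_mul]
  calc |a _| * |b _| ≤ (c * ε ^ (-(N : ℝ))) * (d * ε ^ (δ q - M)) :=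
        mul_le_mul (ha ε hε (hlt.trans_le (min_le_left _ _)))
          (hb ε hε (hlt.trans_le (min_le_right _ _))) (abs_nonneg _) (by positivity)
    _ = c * d * (ε ^ (-(N : ℝ)) * ε ^ (δ q - M)) := by ring
    _ = _ := by rw [← Real.rpow_add hε]; push_cast; ring_nf

/-- A function vanishing eventually along every scaling orbit is negligible. -/
theorem isNegligible_of_eventually
    (h : ∀ φ : A.Idx, ∃ η : ℝ, 0 < η ∧ ∀ (ε : ℝ) (hε : 0 < ε), ε < η → a (A.scale ε hε φ) = 0) :
    IsNegligible A a := by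
  refine ⟨0, _, isGauge_cast, fun q _ φ _ => ?_⟩
  obtain ⟨η, h0, h⟩ := h φ
  refine ⟨1, one_pos, min η 1, lt_min h0 one_pos, min_le_right _ _, fun ε hε hlt => ?_⟩
  rw [h ε hε (hlt.trans_le (min_le_left _ _)), abs_zero]
  positivity

theorem isNegligible_zero : IsNegligible A (fun _ => 0) :=
  isNegligible_of_eventually fun _ => ⟨1, one_pos, fun _ _ _ => rfl⟩

theorem isModerate_const (r : ℝ) : IsModerate A (fun _ => r) := by
  refine ⟨0, fun φ _ => ⟨|r| + 1, by positivity, 1, one_pos, le_rfl, fun ε hε _ => ?_⟩⟩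
  simp

/-- The ring `ℰ_M(ℝ)` of moderate functions `𝒜_0 → ℝ`. -/
def modReal (A : TestFamily 𝕜 m) : Subalgebra ℝ (A.Idx → ℝ) where
  carrier := {a | IsModerate A a}
  mul_mem' := fun ha hb => IsModerate.mul ha hb
  add_mem' := fun ha hb => IsModerate.add ha hb
  algebraMap_mem' := fun r => isModerate_const r

theorem mem_modReal : a ∈ modReal A ↔ IsModerate A a := Iff.rfl

/-- The ideal `𝒩(ℝ)` of negligible functions in `ℰ_M(ℝ)`. -/
def nullReal (A : TestFamily 𝕜 m) : Ideal (modReal A) where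
  carrier := {a | IsNegligible A a.1}
  add_mem' := fun ha hb => IsNegligible.add ha hb
  zero_mem' := isNegligible_zero
  smul_mem' := fun c _ hx => IsModerate.mul_negligible c.2 hx

/-- The ring `ℝ̄ = ℰ_M(ℝ) / 𝒩(ℝ)` of generalized real numbers. -/
def GenReal (A : TestFamily 𝕜 m) : Type _ := modReal A ⧸ nullReal A

instance (A : TestFamily 𝕜 m) : CommRing (GenReal A) :=
  inferInstanceAs (CommRing (modReal A ⧸ nullReal A))

/-- The class of a moderate function. -/
def GenReal.mk (A : TestFamily 𝕜 m) : modReal A →+* GenReal A := Ideal.Quotient.mk (nullReal A)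

theorem GenReal.mk_eq_mk {a b : modReal A} :
    GenReal.mk A a = GenReal.mk A b ↔ IsNegligible A (fun φ => a.1 φ - b.1 φ) :=
  Ideal.Quotient.eq

/-- `x ≤ y` in `ℝ̄` iff `y - x` has a representative that is `≥ 0` on `𝒜_0`. -/
instance GenReal.instLE (A : TestFamily 𝕜 m) : LE (GenReal A) where
  le x y := ∃ a : modReal A, (∀ φ, 0 ≤ a.1 φ) ∧ GenReal.mk A a = y - x

theorem isModerate_suppDiam_pow (r : ℕ) : IsModerate A (fun φ => suppDiam φ.1 ^ r) := by
  refine ⟨0, fun φ _ => ⟨suppDiam φ.1 ^ r + 1, ?_, 1, one_pos, le_rfl, fun ε hε h1 => ?_⟩⟩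
  · have : 0 ≤ suppDiam φ.1 := Metric.diam_nonneg
    positivity
  · have h0 : 0 ≤ suppDiam φ.1 := Metric.diam_nonneg
    have : suppDiam (A.scale ε hε φ).1 = ε * suppDiam φ.1 := suppDiam_scaleFun hε φ.1
    simp only [this]
    rw [mul_pow, abs_of_nonneg (by positivity)]
    have h2 : ε ^ r ≤ 1 := pow_le_one₀ hε.le h1.le
    simp only [Nat.cast_zero, neg_zero, Real.rpow_zero, mul_one]
    nlinarith [pow_nonneg h0 r]

/-- The generalized number `α_r^•`, the class of `φ ↦ i(φ)^r`. -/
def alphaGen (A : TestFamily 𝕜 m) (r : ℕ) : GenReal A :=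
  GenReal.mk A ⟨fun φ => suppDiam φ.1 ^ r, isModerate_suppDiam_pow r⟩

theorem GenReal.add_le_add {x y z w : GenReal A} (h : x ≤ y) (h' : z ≤ w) : x + z ≤ y + w := by
  obtain ⟨a, ha, hxy⟩ := h
  obtain ⟨b, hb, hzw⟩ := h'
  refine ⟨a + b, fun φ => add_nonneg (ha φ) (hb φ), ?_⟩
  rw [map_add, hxy, hzw]
  abel

theorem GenReal.le_trans {x y z : GenReal A} (h : x ≤ y) (h' : y ≤ z) : x ≤ z := by
  obtain ⟨a, ha, hxy⟩ := h
  obtain ⟨b, hb, hzw⟩ := h'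
  refine ⟨a + b, fun φ => add_nonneg (ha φ) (hb φ), ?_⟩
  rw [map_add, hxy, hzw]
  abel

theorem GenReal.mk_le_mk {a b : modReal A}
    (h : ∀ φ : A.Idx, ∃ η : ℝ, 0 < η ∧ ∀ (ε : ℝ) (hε : 0 < ε), ε < η →
      a.1 (A.scale ε hε φ) ≤ b.1 (A.scale ε hε φ)) :
    GenReal.mk A a ≤ GenReal.mk A b := by
  have hm : (fun φ => max (b.1 φ - a.1 φ) 0) ∈ modReal A := by
    refine mem_modReal.2 ?_
    refine IsModerate.mono (b := (b - a).1) (b - a).2 fun φ => ?_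
    rw [abs_of_nonneg (le_max_right _ _)]
    exact max_le (le_abs_self _) (abs_nonneg _)
  refine ⟨⟨_, hm⟩, fun φ => le_max_right _ _, ?_⟩
  rw [← map_sub, GenReal.mk_eq_mk]
  refine isNegligible_of_eventually fun φ => ?_
  obtain ⟨η, h0, h⟩ := h φ
  refine ⟨η, h0, fun ε hε hlt => ?_⟩
  have := h ε hε hlt
  change max (b.1 _ - a.1 _) 0 - (b.1 _ - a.1 _) = 0
  rw [max_eq_left (by linarith), sub_self]

theorem alphaGen_succ_add_le (r : ℕ) :
    alphaGen A (r + 1) + alphaGen A (r + 1) ≤ alphaGen A r := by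
  unfold alphaGen
  rw [← map_add]
  refine GenReal.mk_le_mk fun φ => ?_
  have h0 : 0 ≤ suppDiam φ.1 := Metric.diam_nonneg
  refine ⟨1 / (2 * (suppDiam φ.1 + 1)), by positivity, fun ε hε hlt => ?_⟩
  change suppDiam (scaleFun ε φ.1) ^ (r + 1) + suppDiam (scaleFun ε φ.1) ^ (r + 1)
    ≤ suppDiam (scaleFun ε φ.1) ^ r
  rw [suppDiam_scaleFun hε]
  rw [lt_div_iff₀ (by positivity)] at hlt
  have h1 : 0 ≤ (ε * suppDiam φ.1) ^ r := by positivity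
  have h2 : 2 * (ε * suppDiam φ.1) ≤ 1 := by nlinarith
  rw [pow_succ]
  nlinarith

theorem alphaGen_anti {r s : ℕ} (h : r ≤ s) : alphaGen A s ≤ alphaGen A r := by
  refine GenReal.mk_le_mk fun φ => ?_
  have h0 : 0 ≤ suppDiam φ.1 := Metric.diam_nonneg
  refine ⟨1 / (suppDiam φ.1 + 1), by positivity, fun ε hε hlt => ?_⟩
  change suppDiam (scaleFun ε φ.1) ^ s ≤ suppDiam (scaleFun ε φ.1) ^ r
  rw [suppDiam_scaleFun hε]
  rw [lt_div_iff₀ (by positivity)] at hlt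
  exact pow_le_pow_of_le_one (by positivity) (by nlinarith) h

theorem zero_le_alphaGen (r : ℕ) : 0 ≤ alphaGen A r :=
  ⟨_, fun φ => pow_nonneg (Metric.diam_nonneg (s := tsupport φ.1)) r, (sub_zero _).symm⟩

end Numbers

/-! ### Calculus of partial derivatives on an open set -/

section Calculus

variable {𝕜 : Type*} [RCLike 𝕜] {m : ℕ} {Ω : Set (E m)} {f g : E m → 𝕜}

theorem pderiv_congr (hΩ : IsOpen Ω) (i : Fin m) (h : EqOn f g Ω) :
    EqOn (pderiv i f) (pderiv i g) Ω := fun x hx => by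
  have : f =ᶠ[nhds x] g := Filter.eventuallyEq_of_mem (hΩ.mem_nhds hx) h
  simp only [pderiv, this.fderiv_eq]

theorem pderiv_smooth (hΩ : IsOpen Ω) (i : Fin m) (h : ContDiffOn ℝ ∞ f Ω) :
    ContDiffOn ℝ ∞ (pderiv i f) Ω :=
  (h.fderiv_of_isOpen hΩ (m := ∞) (by simp)).clm_apply contDiffOn_const

theorem diffAt (hΩ : IsOpen Ω) (h : ContDiffOn ℝ ∞ f Ω) {x : E m} (hx : x ∈ Ω) :
    DifferentiableAt ℝ f x :=
  (h.contDiffAt (hΩ.mem_nhds hx)).differentiableAt (by simp)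

theorem pderiv_add (hΩ : IsOpen Ω) (i : Fin m) (hf : ContDiffOn ℝ ∞ f Ω)
    (hg : ContDiffOn ℝ ∞ g Ω) : EqOn (pderiv i (f + g)) (pderiv i f + pderiv i g) Ω := by
  intro x hx
  simp [pderiv, fderiv_add (diffAt hΩ hf hx) (diffAt hΩ hg hx)]

theorem pderiv_mul (hΩ : IsOpen Ω) (i : Fin m) (hf : ContDiffOn ℝ ∞ f Ω)
    (hg : ContDiffOn ℝ ∞ g Ω) :
    EqOn (pderiv i (f * g)) (pderiv i f * g + f * pderiv i g) Ω := by
  intro x hx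
  simp [pderiv, fderiv_mul (diffAt hΩ hf hx) (diffAt hΩ hg hx)]
  ring

theorem pderiv_neg (i : Fin m) (f : E m → 𝕜) : pderiv i (-f) = -pderiv i f := by
  funext x
  simp [pderiv, fderiv_neg]

theorem pderiv_comm (hΩ : IsOpen Ω) (i j : Fin m) (hf : ContDiffOn ℝ ∞ f Ω) :
    EqOn (pderiv i (pderiv j f)) (pderiv j (pderiv i f)) Ω := by
  intro x hx
  have hs : IsSymmSndFDerivAt ℝ f x :=
    (hf.contDiffAt (hΩ.mem_nhds hx)).isSymmSndFDerivAt
      (by simp only [minSmoothness_of_isRCLikeNormedField]; exact WithTop.coe_le_coe.2 le_top)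
  have hd : DifferentiableAt ℝ (fderiv ℝ f) x :=
    ((hf.fderiv_of_isOpen hΩ (m := ∞) (by simp)).contDiffAt
      (hΩ.mem_nhds hx)).differentiableAt (by simp)
  have key : ∀ v w : E m, fderiv ℝ (fun y => fderiv ℝ f y v) x w = fderiv ℝ (fderiv ℝ f) x w v := by
    intro v w
    rw [fderiv_clm_apply hd (differentiableAt_const v)]
    simp
  simp only [pderiv]
  change fderiv ℝ (fun y => fderiv ℝ f y _) x _ = fderiv ℝ (fun y => fderiv ℝ f y _) x _
  rw [key, key]
  exact hs.eq _ _

theorem iter_congr (hΩ : IsOpen Ω) (i : Fin m) (n : ℕ) (h : EqOn f g Ω) :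
    EqOn ((pderiv i)^[n] f) ((pderiv i)^[n] g) Ω := by
  induction n generalizing f g with
  | zero => exact h
  | succ n ih => exact ih (pderiv_congr hΩ i h)

theorem iter_smooth (hΩ : IsOpen Ω) (i : Fin m) (n : ℕ) (h : ContDiffOn ℝ ∞ f Ω) :
    ContDiffOn ℝ ∞ ((pderiv i)^[n] f) Ω := by
  induction n generalizing f with
  | zero => exact h
  | succ n ih => exact ih (pderiv_smooth hΩ i h)

theorem iter_add (hΩ : IsOpen Ω) (i : Fin m) (n : ℕ) (hf : ContDiffOn ℝ ∞ f Ω)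
    (hg : ContDiffOn ℝ ∞ g Ω) :
    EqOn ((pderiv i)^[n] (f + g)) ((pderiv i)^[n] f + (pderiv i)^[n] g) Ω := by
  induction n generalizing f g with
  | zero => exact fun _ _ => rfl
  | succ n ih =>
    exact (iter_congr hΩ i n (pderiv_add hΩ i hf hg)).trans
      (ih (pderiv_smooth hΩ i hf) (pderiv_smooth hΩ i hg))

theorem iter_neg (i : Fin m) (n : ℕ) (f : E m → 𝕜) :
    (pderiv i)^[n] (-f) = -(pderiv i)^[n] f := by
  induction n generalizing f with
  | zero => rfl
  | succ n ih => rw [Function.iterate_succ_apply, pderiv_neg, ih]; rfl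

theorem iter_comm (hΩ : IsOpen Ω) (i j : Fin m) (n : ℕ) (hf : ContDiffOn ℝ ∞ f Ω) :
    EqOn ((pderiv i)^[n] (pderiv j f)) (pderiv j ((pderiv i)^[n] f)) Ω := by
  induction n generalizing f with
  | zero => exact fun _ _ => rfl
  | succ n ih =>
    exact (iter_congr hΩ i n (pderiv_comm hΩ i j hf)).trans (ih (pderiv_smooth hΩ i hf))

variable (L : List (Fin m)) (σ : Fin m → ℕ)

theorem listDeriv_congr (hΩ : IsOpen Ω) (h : EqOn f g Ω) :
    EqOn (listDeriv L σ f) (listDeriv L σ g) Ω := by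
  induction L with
  | nil => exact h
  | cons i L ih => exact iter_congr hΩ i _ ih

theorem listDeriv_smooth (hΩ : IsOpen Ω) (h : ContDiffOn ℝ ∞ f Ω) :
    ContDiffOn ℝ ∞ (listDeriv L σ f) Ω := by
  induction L with
  | nil => exact h
  | cons i L ih => exact iter_smooth hΩ i _ ih

theorem listDeriv_add (hΩ : IsOpen Ω) (hf : ContDiffOn ℝ ∞ f Ω) (hg : ContDiffOn ℝ ∞ g Ω) :
    EqOn (listDeriv L σ (f + g)) (listDeriv L σ f + listDeriv L σ g) Ω := by
  induction L with
  | nil => exact fun _ _ => rfl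
  | cons i L ih =>
    exact (iter_congr hΩ i _ ih).trans
      (iter_add hΩ i _ (listDeriv_smooth L σ hΩ hf) (listDeriv_smooth L σ hΩ hg))

theorem listDeriv_neg (f : E m → 𝕜) : listDeriv L σ (-f) = -listDeriv L σ f := by
  induction L with
  | nil => rfl
  | cons i L ih =>
    change (pderiv i)^[σ i] (listDeriv L σ (-f)) = -(pderiv i)^[σ i] (listDeriv L σ f)
    rw [ih, iter_neg]

theorem listDeriv_pderiv (hΩ : IsOpen Ω) (j : Fin m) (hf : ContDiffOn ℝ ∞ f Ω) :
    EqOn (listDeriv L σ (pderiv j f)) (pderiv j (listDeriv L σ f)) Ω := by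
  induction L with
  | nil => exact fun _ _ => rfl
  | cons i L ih =>
    exact (iter_congr hΩ i _ ih).trans (iter_comm hΩ i j _ (listDeriv_smooth L σ hΩ hf))

theorem listDeriv_of_notMem (j : Fin m) (hj : j ∉ L) :
    listDeriv L (σ + Pi.single j 1) f = listDeriv L σ f := by
  induction L with
  | nil => rfl
  | cons i L ih =>
    rw [List.mem_cons, not_or] at hj
    change (pderiv i)^[(σ + Pi.single j 1 : Fin m → ℕ) i] (listDeriv L (σ + Pi.single j 1) f) = _
    rw [ih hj.2, Pi.add_apply, Pi.single_eq_of_ne (Ne.symm hj.1), add_zero]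
    rfl

theorem listDeriv_add_single (hΩ : IsOpen Ω) (j : Fin m) (hL : L.Nodup) (hj : j ∈ L)
    (hf : ContDiffOn ℝ ∞ f Ω) :
    EqOn (listDeriv L (σ + Pi.single j 1) f) (listDeriv L σ (pderiv j f)) Ω := by
  induction L with
  | nil => simp at hj
  | cons i L ih =>
    rw [List.nodup_cons] at hL
    change EqOn ((pderiv i)^[(σ + Pi.single j 1 : Fin m → ℕ) i] (listDeriv L (σ + Pi.single j 1) f))
      ((pderiv i)^[σ i] (listDeriv L σ (pderiv j f))) Ω
    by_cases h : j = i
    · subst h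
      rw [listDeriv_of_notMem L σ j hL.1, Pi.add_apply, Pi.single_eq_same,
        Function.iterate_succ_apply]
      exact iter_congr hΩ j _ (listDeriv_pderiv L σ hΩ j hf).symm
    · rw [Pi.add_apply, Pi.single_eq_of_ne (Ne.symm h), add_zero]
      exact iter_congr hΩ i _ (ih hL.2 (List.mem_of_ne_of_mem h hj))

theorem multiDeriv_zero (f : E m → 𝕜) : multiDeriv 0 f = f := by
  unfold multiDeriv
  induction List.finRange m with
  | nil => rfl
  | cons i L ih => exact ih

theorem listDeriv_const (c : 𝕜) : ∃ d : 𝕜, listDeriv L σ (fun _ : E m => c) = fun _ => d := by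
  induction L with
  | nil => exact ⟨c, rfl⟩
  | cons i L ih =>
    obtain ⟨d, hd⟩ := ih
    change ∃ e : 𝕜, (pderiv i)^[σ i] (listDeriv L σ fun _ => c) = fun _ => e
    rw [hd]
    generalize σ i = n
    induction n with
    | zero => exact ⟨d, rfl⟩
    | succ n ih' =>
      obtain ⟨e, he⟩ := ih'
      refine ⟨0, ?_⟩
      rw [Function.iterate_succ_apply', he]
      funext x
      simp [pderiv]

variable {K : Set (E m)}

theorem supNorm_nonneg (K : Set (E m)) (f : E m → 𝕜) : 0 ≤ supNorm K f :=
  Real.iSup_nonneg fun _ => norm_nonneg _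

theorem le_supNorm (hK : IsCompact K) (hf : ContinuousOn f K) {x : E m} (hx : x ∈ K) :
    ‖f x‖ ≤ supNorm K f := by
  have hb : BddAbove (Set.range fun x : K => ‖f x‖) := by
    have := hK.bddAbove_image hf.norm
    rwa [Set.image_eq_range] at this
  exact le_ciSup hb ⟨x, hx⟩

theorem supNorm_le {c : ℝ} (hc : 0 ≤ c) (h : ∀ x ∈ K, ‖f x‖ ≤ c) : supNorm K f ≤ c :=
  Real.iSup_le (fun x => h x x.2) hc

theorem supNorm_congr (h : EqOn f g K) : supNorm K f = supNorm K g :=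
  iSup_congr fun x => by rw [h x.2]

theorem supNorm_add_le (hK : IsCompact K) (hf : ContinuousOn f K) (hg : ContinuousOn g K) :
    supNorm K (f + g) ≤ supNorm K f + supNorm K g :=
  supNorm_le (add_nonneg (supNorm_nonneg K f) (supNorm_nonneg K g)) fun _ hx =>
    (norm_add_le _ _).trans (add_le_add (le_supNorm hK hf hx) (le_supNorm hK hg hx))

theorem supNorm_mul_le (hK : IsCompact K) (hf : ContinuousOn f K) (hg : ContinuousOn g K) :
    supNorm K (f * g) ≤ supNorm K f * supNorm K g :=
  supNorm_le (mul_nonneg (supNorm_nonneg K f) (supNorm_nonneg K g)) fun x hx => by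
    rw [Pi.mul_apply, norm_mul]
    exact mul_le_mul (le_supNorm hK hf hx) (le_supNorm hK hg hx) (norm_nonneg _)
      (supNorm_nonneg K f)

theorem supNorm_neg (K : Set (E m)) (f : E m → 𝕜) : supNorm K (-f) = supNorm K f :=
  iSup_congr fun x => by simp

theorem multiDeriv_continuousOn (hΩ : IsOpen Ω) (hKΩ : K ⊆ Ω) (hf : ContDiffOn ℝ ∞ f Ω) :
    ContinuousOn (multiDeriv σ f) K :=
  (listDeriv_smooth _ σ hΩ hf).continuousOn.mono hKΩ

theorem supNorm_multiDeriv_add_le (hΩ : IsOpen Ω) (hK : IsCompact K) (hKΩ : K ⊆ Ω)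
    (hf : ContDiffOn ℝ ∞ f Ω) (hg : ContDiffOn ℝ ∞ g Ω) :
    supNorm K (multiDeriv σ (f + g))
      ≤ supNorm K (multiDeriv σ f) + supNorm K (multiDeriv σ g) := by
  have h := supNorm_congr ((listDeriv_add (List.finRange m) σ hΩ hf hg).mono hKΩ)
  rw [show multiDeriv σ (f + g) = listDeriv (List.finRange m) σ (f + g) from rfl, h]
  exact supNorm_add_le hK (multiDeriv_continuousOn σ hΩ hKΩ hf)
    (multiDeriv_continuousOn σ hΩ hKΩ hg)

theorem supNorm_multiDeriv_neg (K : Set (E m)) (f : E m → 𝕜) :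
    supNorm K (multiDeriv σ (-f)) = supNorm K (multiDeriv σ f) := by
  rw [multiDeriv, listDeriv_neg, supNorm_neg, multiDeriv]

theorem supNorm_multiDeriv_zero (K : Set (E m)) :
    supNorm K (multiDeriv σ (0 : E m → 𝕜)) = 0 := by
  have h : multiDeriv σ (0 : E m → 𝕜) = 0 := by
    have := listDeriv_neg (List.finRange m) σ (0 : E m → 𝕜)
    rw [neg_zero] at this
    exact self_eq_neg.1 this
  rw [h]
  exact le_antisymm (supNorm_le le_rfl (by simp)) (supNorm_nonneg _ _)

theorem abs_supNorm_multiDeriv_sub_le (hΩ : IsOpen Ω) (hK : IsCompact K) (hKΩ : K ⊆ Ω)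
    (hf : ContDiffOn ℝ ∞ f Ω) (hg : ContDiffOn ℝ ∞ g Ω) :
    |supNorm K (multiDeriv σ f) - supNorm K (multiDeriv σ g)|
      ≤ supNorm K (multiDeriv σ (f - g)) := by
  have h1 := supNorm_multiDeriv_add_le σ hΩ hK hKΩ (hf.sub hg) hg
  have h2 := supNorm_multiDeriv_add_le σ hΩ hK hKΩ (hg.sub hf) hf
  have e1 : (fun x => f x - g x) + g = f := by funext x; simp
  have e2 : (fun x => g x - f x) + f = g := by funext x; simp
  have e3 : (fun x => g x - f x) = -(f - g) := by funext x; simp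
  rw [e1] at h1
  rw [e2, e3, supNorm_multiDeriv_neg] at h2
  have h1' : supNorm K (multiDeriv σ f)
    ≤ supNorm K (multiDeriv σ (f - g)) + supNorm K (multiDeriv σ g) := h1
  rw [abs_le]
  constructor <;> linarith

/-- Abstract form of the closure of growth conditions under products, by Leibniz' rule. -/
theorem growth_mul {ι : Type*} {P Q : (ι → ℝ) → Prop}
    (hmono : ∀ a b : ι → ℝ, (∀ φ, |a φ| ≤ |b φ|) → P b → P a)
    (hadd : ∀ a b : ι → ℝ, P a → P b → P (fun φ => a φ + b φ))
    (hmul : ∀ a b : ι → ℝ, Q a → P b → P (fun φ => a φ * b φ))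
    (hΩ : IsOpen Ω) (hK : IsCompact K) (hKΩ : K ⊆ Ω) (n : ℕ) :
    ∀ (u v : ι → E m → 𝕜), (∀ φ, ContDiffOn ℝ ∞ (u φ) Ω) → (∀ φ, ContDiffOn ℝ ∞ (v φ) Ω) →
      (∀ σ, Q fun φ => supNorm K (multiDeriv σ (u φ))) →
      (∀ σ, P fun φ => supNorm K (multiDeriv σ (v φ))) →
      ∀ σ : Fin m → ℕ, ∑ i, σ i = n → P fun φ => supNorm K (multiDeriv σ (u φ * v φ)) := by
  induction n with
  | zero =>
    intro u v hu hv hQ hP σ hσ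
    have h0 : σ = 0 := by
      funext i
      exact (Finset.sum_eq_zero_iff.1 hσ) i (Finset.mem_univ i)
    subst h0
    refine hmono _ _ (fun φ => ?_) (hmul _ _ (hQ 0) (hP 0))
    simp only [multiDeriv_zero]
    rw [abs_of_nonneg (supNorm_nonneg _ _),
      abs_of_nonneg (mul_nonneg (supNorm_nonneg _ _) (supNorm_nonneg _ _))]
    exact supNorm_mul_le hK ((hu φ).continuousOn.mono hKΩ) ((hv φ).continuousOn.mono hKΩ)
  | succ n ih =>
    intro u v hu hv hQ hP σ hσ
    obtain ⟨j, hj⟩ : ∃ j, σ j ≠ 0 := by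
      by_contra! h
      simp [h] at hσ
    obtain ⟨τ, rfl⟩ : ∃ τ : Fin m → ℕ, σ = τ + Pi.single j 1 := by
      refine ⟨σ - Pi.single j 1, ?_⟩
      funext i
      by_cases h : i = j
      · subst h
        simp
        omega
      · simp [h]
    have hτ : ∑ i, τ i = n := by
      simp only [Pi.add_apply, Finset.sum_add_distrib, Finset.sum_pi_single', Finset.mem_univ,
        if_true] at hσ
      have : ∑ i, (Pi.single j 1 : Fin m → ℕ) i = 1 := by simp
      omega
    have hstep : ∀ (w : E m → 𝕜), ContDiffOn ℝ ∞ w Ω → ∀ ρ : Fin m → ℕ,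
        supNorm K (multiDeriv (ρ + Pi.single j 1) w) = supNorm K (multiDeriv ρ (pderiv j w)) :=
      fun w hw ρ => supNorm_congr ((listDeriv_add_single _ ρ hΩ j (List.nodup_finRange m)
        (List.mem_finRange j) hw).mono hKΩ)
    have p1 := ih (fun φ => pderiv j (u φ)) v (fun φ => pderiv_smooth hΩ j (hu φ)) hv
      (fun ρ => (funext fun φ => hstep _ (hu φ) ρ : _ = _) ▸ hQ (ρ + Pi.single j 1)) hP τ hτ
    have p2 := ih u (fun φ => pderiv j (v φ)) hu (fun φ => pderiv_smooth hΩ j (hv φ)) hQ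
      (fun ρ => (funext fun φ => hstep _ (hv φ) ρ : _ = _) ▸ hP (ρ + Pi.single j 1)) τ hτ
    refine hmono _ _ (fun φ => ?_) (hadd _ _ p1 p2)
    rw [abs_of_nonneg (supNorm_nonneg _ _),
      abs_of_nonneg (add_nonneg (supNorm_nonneg _ _) (supNorm_nonneg _ _)),
      hstep (u φ * v φ) ((hu φ).mul (hv φ)),
      show supNorm K (multiDeriv τ (pderiv j (u φ * v φ))) = _ from
        supNorm_congr ((listDeriv_congr _ τ hΩ (pderiv_mul hΩ j (hu φ) (hv φ))).mono hKΩ)]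
    exact supNorm_multiDeriv_add_le τ hΩ hK hKΩ ((pderiv_smooth hΩ j (hu φ)).mul (hv φ))
      ((hu φ).mul (pderiv_smooth hΩ j (hv φ)))

end Calculus

/-! ### The Colombeau algebra -/

section Algebra

variable {𝕜 : Type*} [RCLike 𝕜] {m : ℕ}

/-- The algebra `ℰ_M[Ω]` of functions `u : 𝒜_0 × Ω → 𝕜` such that every `u(φ, ·)` is smooth on `Ω` and
for every compact `K ⊆ Ω` and every `σ ∈ ℕ^m` the function `φ ↦ ‖∂^σ u(φ, ·)‖_K` is moderate.
An element is represented by functions on all of `ℝ^m`; the values outside `Ω` do not matter: they do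
not enter the conditions, and functions that agree on `Ω` differ by an element of `nullFun`. -/
def modFun (A : TestFamily 𝕜 m) (Ω : TopologicalSpace.Opens (E m)) :
    Subalgebra 𝕜 (A.Idx → E m → 𝕜) where
  carrier := {u | (∀ φ, ContDiffOn ℝ ∞ (u φ) Ω) ∧
    ∀ K : Set (E m), IsCompact K → K ⊆ Ω → ∀ σ : Fin m → ℕ,
      IsModerate A fun φ => supNorm K (multiDeriv σ (u φ))}
  mul_mem' := by
    rintro u v ⟨hu, hu'⟩ ⟨hv, hv'⟩
    exact ⟨fun φ => (hu φ).mul (hv φ), fun K hK hKΩ σ =>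
      growth_mul (P := IsModerate A) (Q := IsModerate A)
        (fun _ _ h h' => IsModerate.mono h' h) (fun _ _ h h' => IsModerate.add h h')
        (fun _ _ h h' => IsModerate.mul h h') Ω.isOpen hK hKΩ _ u v hu hv (hu' K hK hKΩ)
        (hv' K hK hKΩ) σ rfl⟩
  add_mem' := by
    rintro u v ⟨hu, hu'⟩ ⟨hv, hv'⟩
    refine ⟨fun φ => (hu φ).add (hv φ), fun K hK hKΩ σ =>
      IsModerate.mono (IsModerate.add (hu' K hK hKΩ σ) (hv' K hK hKΩ σ)) fun φ => ?_⟩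
    rw [abs_of_nonneg (supNorm_nonneg _ _),
      abs_of_nonneg (add_nonneg (supNorm_nonneg _ _) (supNorm_nonneg _ _))]
    exact supNorm_multiDeriv_add_le σ Ω.isOpen hK hKΩ (hu φ) (hv φ)
  algebraMap_mem' := by
    intro c
    refine ⟨fun φ => contDiffOn_const, fun K hK hKΩ σ => ?_⟩
    obtain ⟨d, hd⟩ := listDeriv_const (𝕜 := 𝕜) (List.finRange m) σ c
    have : (fun φ : A.Idx => supNorm K (multiDeriv σ
        ((algebraMap 𝕜 (A.Idx → E m → 𝕜) c) φ))) = fun _ => supNorm K fun _ => d := by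
      funext φ
      exact congrArg (supNorm K) hd
    rw [this]
    exact isModerate_const _

/-- The ideal `𝒩[Ω]` of those `u ∈ ℰ_M[Ω]` for which every `φ ↦ ‖∂^σ u(φ, ·)‖_K` is negligible. -/
def nullFun (A : TestFamily 𝕜 m) (Ω : TopologicalSpace.Opens (E m)) : Ideal (modFun A Ω) where
  carrier := {u | ∀ K : Set (E m), IsCompact K → K ⊆ Ω → ∀ σ : Fin m → ℕ,
    IsNegligible A fun φ => supNorm K (multiDeriv σ (u.1 φ))}
  add_mem' := by
    intro u v hu hv K hK hKΩ σ
    refine IsNegligible.mono (IsNegligible.add (hu K hK hKΩ σ) (hv K hK hKΩ σ)) fun φ => ?_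
    rw [abs_of_nonneg (supNorm_nonneg _ _),
      abs_of_nonneg (add_nonneg (supNorm_nonneg _ _) (supNorm_nonneg _ _))]
    exact supNorm_multiDeriv_add_le σ Ω.isOpen hK hKΩ (u.2.1 φ) (v.2.1 φ)
  zero_mem' := by
    intro K hK hKΩ σ
    have h : (fun φ : A.Idx => supNorm K (multiDeriv σ ((0 : modFun A Ω).1 φ))) = fun _ => 0 :=
      funext fun _ => supNorm_multiDeriv_zero σ K
    rw [h]
    exact isNegligible_zero
  smul_mem' := by
    intro u v hv K hK hKΩ σ
    exact growth_mul (P := IsNegligible A) (Q := IsModerate A)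
      (fun _ _ h h' => IsNegligible.mono h' h)
      (fun _ _ h h' => IsNegligible.add h h')
      (fun _ _ h h' => IsModerate.mul_negligible h h') Ω.isOpen hK hKΩ _ u.1 v.1 u.2.1 v.2.1
      (u.2.2 K hK hKΩ) (hv K hK hKΩ) σ rfl

/-- The Colombeau algebra `𝒢(Ω) = ℰ_M[Ω] / 𝒩[Ω]`. -/
def GenFun (A : TestFamily 𝕜 m) (Ω : TopologicalSpace.Opens (E m)) : Type _ :=
  modFun A Ω ⧸ nullFun A Ω

instance (A : TestFamily 𝕜 m) (Ω : TopologicalSpace.Opens (E m)) : CommRing (GenFun A Ω) :=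
  inferInstanceAs (CommRing (modFun A Ω ⧸ nullFun A Ω))

instance (A : TestFamily 𝕜 m) (Ω : TopologicalSpace.Opens (E m)) : Algebra 𝕜 (GenFun A Ω) :=
  inferInstanceAs (Algebra 𝕜 (modFun A Ω ⧸ nullFun A Ω))

/-- The class of a moderate function. -/
def GenFun.mk (A : TestFamily 𝕜 m) (Ω : TopologicalSpace.Opens (E m)) :
    modFun A Ω →ₐ[𝕜] GenFun A Ω :=
  Ideal.Quotient.mkₐ 𝕜 (nullFun A Ω)

theorem GenFun.mk_surjective (A : TestFamily 𝕜 m) (Ω : TopologicalSpace.Opens (E m)) :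
    Function.Surjective (GenFun.mk A Ω) := Ideal.Quotient.mk_surjective

/-! ### The topology `𝒯_Ω` -/

/-- An exhaustive sequence of open subsets of `Ω`: the closure of `Ω_l` is a compact subset of
`Ω_{l+1}`, and the union of the `Ω_l` is `Ω`. -/
structure Exhaustion (Ω : TopologicalSpace.Opens (E m)) where
  sets : ℕ → Set (E m)
  isOpen : ∀ l, IsOpen (sets l)
  isCompact_closure : ∀ l, IsCompact (closure (sets l))
  closure_subset_succ : ∀ l, closure (sets l) ⊆ sets (l + 1)
  iUnion_eq : ⋃ l, sets l = Ω

variable {Ω : TopologicalSpace.Opens (E m)} {A : TestFamily 𝕜 m}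

theorem Exhaustion.closure_subset (e : Exhaustion Ω) (l : ℕ) : closure (e.sets l) ⊆ Ω := by
  rw [← e.iUnion_eq]
  exact (e.closure_subset_succ l).trans (Set.subset_iUnion e.sets (l + 1))

theorem Exhaustion.mono (e : Exhaustion Ω) : Monotone e.sets :=
  monotone_nat_of_le_succ fun l => subset_closure.trans (e.closure_subset_succ l)

/-- The moderate function `φ ↦ ‖∂^σ u(φ, ·)‖_l`, the supremum being taken over the closure of
`Ω_l`. -/
def normRep (e : Exhaustion Ω) (l : ℕ) (σ : Fin m → ℕ) (u : modFun A Ω) : modReal A :=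
  ⟨fun φ => supNorm (closure (e.sets l)) (multiDeriv σ (u.1 φ)),
    u.2.2 _ (e.isCompact_closure l) (e.closure_subset l) σ⟩

/-- `‖f‖_{l,σ} ∈ ℝ̄`, the class of `φ ↦ ‖∂^σ u(φ, ·)‖_l` for any representative `u` of `f`. -/
def normGen (e : Exhaustion Ω) (l : ℕ) (σ : Fin m → ℕ) : GenFun A Ω → GenReal A :=
  Quotient.lift (fun u : modFun A Ω => GenReal.mk A (normRep e l σ u)) fun u v huv => by
    have h : u - v ∈ nullFun A Ω := (Submodule.quotientRel_def _).1 huv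
    rw [GenReal.mk_eq_mk]
    refine IsNegligible.mono (h _ (e.isCompact_closure l) (e.closure_subset l) σ) fun φ => ?_
    rw [abs_of_nonneg (supNorm_nonneg (closure (e.sets l)) _)]
    exact abs_supNorm_multiDeriv_sub_le σ Ω.isOpen (e.isCompact_closure l) (e.closure_subset l)
      (u.2.1 φ) (v.2.1 φ)

theorem normGen_mk (e : Exhaustion Ω) (l : ℕ) (σ : Fin m → ℕ) (u : modFun A Ω) :
    normGen e l σ (GenFun.mk A Ω u) = GenReal.mk A (normRep e l σ u) := rfl

/-- The set `W^σ_{l,r}` of all `f ∈ 𝒢(Ω)` with `‖f‖_{l,κ} ≤ α_r^•` for all `κ ≤ σ`. -/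
def basicNhd (A : TestFamily 𝕜 m) (e : Exhaustion Ω) (l : ℕ) (σ : Fin m → ℕ) (r : ℕ) :
    Set (GenFun A Ω) :=
  {f | ∀ κ, κ ≤ σ → normGen e l κ f ≤ alphaGen A r}

theorem GenReal.mk_le_mk' {a b : modReal A} (h : ∀ φ, a.1 φ ≤ b.1 φ) :
    GenReal.mk A a ≤ GenReal.mk A b :=
  GenReal.mk_le_mk fun _ => ⟨1, one_pos, fun _ _ _ => h _⟩

theorem normGen_zero (e : Exhaustion Ω) (l : ℕ) (σ : Fin m → ℕ) :
    normGen e l σ (0 : GenFun A Ω) = 0 := by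
  rw [← map_zero (GenFun.mk A Ω), normGen_mk, ← map_zero (GenReal.mk A)]
  congr 1
  apply Subtype.ext
  funext φ
  exact supNorm_multiDeriv_zero σ _

theorem normGen_add_le (e : Exhaustion Ω) (l : ℕ) (σ : Fin m → ℕ) (f g : GenFun A Ω) :
    normGen e l σ (f + g) ≤ normGen e l σ f + normGen e l σ g := by
  obtain ⟨u, rfl⟩ := GenFun.mk_surjective A Ω f
  obtain ⟨v, rfl⟩ := GenFun.mk_surjective A Ω g
  rw [← map_add, normGen_mk, normGen_mk, normGen_mk, ← map_add]
  exact GenReal.mk_le_mk' fun φ => supNorm_multiDeriv_add_le σ Ω.isOpen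
    (e.isCompact_closure l) (e.closure_subset l) (u.2.1 φ) (v.2.1 φ)

theorem normGen_neg (e : Exhaustion Ω) (l : ℕ) (σ : Fin m → ℕ) (f : GenFun A Ω) :
    normGen e l σ (-f) = normGen e l σ f := by
  obtain ⟨u, rfl⟩ := GenFun.mk_surjective A Ω f
  rw [← map_neg, normGen_mk, normGen_mk]
  congr 1
  apply Subtype.ext
  funext φ
  exact supNorm_multiDeriv_neg σ _ (u.1 φ)

theorem normGen_mono (e : Exhaustion Ω) {l k : ℕ} (h : l ≤ k) (σ : Fin m → ℕ) (f : GenFun A Ω) :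
    normGen e l σ f ≤ normGen e k σ f := by
  obtain ⟨u, rfl⟩ := GenFun.mk_surjective A Ω f
  rw [normGen_mk, normGen_mk]
  exact GenReal.mk_le_mk' fun φ => supNorm_le (supNorm_nonneg _ _) fun x hx =>
    le_supNorm (e.isCompact_closure k)
      (multiDeriv_continuousOn σ Ω.isOpen (e.closure_subset k) (u.2.1 φ))
      (closure_mono (e.mono h) hx)

/-- The filter basis of all `W^σ_{l,r}` with `l ∈ ℕ`, `σ ∈ ℕ^m` and `r ∈ ℕ`, `r ≥ 1`. -/
@[reducible]
def basis (A : TestFamily 𝕜 m) (e : Exhaustion Ω) : AddGroupFilterBasis (GenFun A Ω) :=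
  addGroupFilterBasisOfComm {W | ∃ l σ r, 1 ≤ r ∧ W = basicNhd A e l σ r}
    ⟨_, 0, 0, 1, le_rfl, rfl⟩
    (by
      rintro _ _ ⟨l, σ, r, hr, rfl⟩ ⟨k, τ, s, hs, rfl⟩
      refine ⟨_, ⟨max l k, σ ⊔ τ, max r s, hr.trans (le_max_left _ _), rfl⟩, fun f hf => ⟨?_, ?_⟩⟩
      · exact fun κ hκ => GenReal.le_trans (normGen_mono e (le_max_left l k) κ f)
          (GenReal.le_trans (hf κ (hκ.trans le_sup_left)) (alphaGen_anti (le_max_left r s)))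
      · exact fun κ hκ => GenReal.le_trans (normGen_mono e (le_max_right l k) κ f)
          (GenReal.le_trans (hf κ (hκ.trans le_sup_right)) (alphaGen_anti (le_max_right r s))))
    (by
      rintro _ ⟨l, σ, r, hr, rfl⟩ κ _
      rw [normGen_zero]
      exact zero_le_alphaGen r)
    (by
      rintro _ ⟨l, σ, r, hr, rfl⟩
      refine ⟨_, ⟨l, σ, r + 1, by omega, rfl⟩, ?_⟩
      rintro _ ⟨f, hf, g, hg, rfl⟩ κ hκ
      exact GenReal.le_trans (normGen_add_le e l κ f g)
        (GenReal.le_trans (GenReal.add_le_add (hf κ hκ) (hg κ hκ)) (alphaGen_succ_add_le r)))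
    (by
      rintro _ ⟨l, σ, r, hr, rfl⟩
      refine ⟨_, ⟨l, σ, r, hr, rfl⟩, fun f hf κ hκ => ?_⟩
      rw [normGen_neg]
      exact hf κ hκ)

/-- The topology `𝒯_Ω` on `𝒢(Ω)`: the translation-invariant topology for which the sets `W^σ_{l,r}`
are a fundamental system of neighbourhoods of `0`. -/
@[reducible]
def topology (A : TestFamily 𝕜 m) (e : Exhaustion Ω) : TopologicalSpace (GenFun A Ω) :=
  (basis A e).topology

theorem isTopologicalAddGroup (A : TestFamily 𝕜 m) (e : Exhaustion Ω) :
    @IsTopologicalAddGroup (GenFun A Ω) (topology A e) _ :=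
  (basis A e).isTopologicalAddGroup

/-- `𝒢(Ω)` with the topology `𝒯_Ω` is complete, that is, complete for the uniform structure of the
topological additive group `(𝒢(Ω), 𝒯_Ω)`. -/
def IsCompleteGenFun (A : TestFamily 𝕜 m) (e : Exhaustion Ω) : Prop :=
  letI : TopologicalSpace (GenFun A Ω) := topology A e
  haveI : IsTopologicalAddGroup (GenFun A Ω) := isTopologicalAddGroup A e
  letI : UniformSpace (GenFun A Ω) := IsTopologicalAddGroup.rightUniformSpace (GenFun A Ω)
  CompleteSpace (GenFun A Ω)

end Algebra

end Colombeau

end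

/-! The neighbourhoods `W^σ_{l,r}` shrink as `l`, `σ`, `r` grow, so the diagonal ones form a
countable basis at `0`. It therefore suffices to find limits of sequences `f_n` with `f_{n+1} - f_n`
in the diagonal neighbourhood of level `n`, with exponent `n + 1` (`isCompleteGenFun_of_sequences`).

Let `v_n` represent `f_n`. When `i(φ) > 0`, a negligible function is eventually below any given
power of `i(φ)`, where "eventually" refers to `orbitFilter`. Hence, for each fixed `n`, the
derivatives of `v_{n+1} - v_n` of order at most `(n,…,n)` are eventually bounded by `2 i(φ)^{n+1}`
on the closure of `Ω_n`. The index `q` and the threshold on `ε` depend on `n`, so no single `φ` need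
satisfy all these bounds, and the full telescoping series need not converge.

The remedy is to decide separately for each `φ` which increments to add: `glue` keeps only those `n`
whose bound holds at this `φ`, and only `n < 1 / i(φ)`. The sum is finite, hence smooth. Its part
with `n ≥ k` is at most `i(φ)^k` by comparison with a geometric series, for every `φ`
(`supNorm_tail_le`). The part with `n < k` has at most `k` moderate terms, so `glue` is moderate.
Eventually no `n < k` is discarded, the head telescopes to `v_k - v_0`, and `glue - v_k` is exactly
the tail. So `f_k` minus the class of `glue` lies in the diagonal neighbourhood of level `k`.

Positivity of `i(φ)` follows from `∫ φ = 1` if `m ≥ 1`. For `m = 0` all `i(φ)` vanish, the basic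
neighbourhoods stabilize, and the sequence is eventually constant up to elements of every one of
them. -/

noncomputable section

namespace Colombeau

/-! ### Properties holding eventually along scaling orbits, and the order of generalized numbers -/

section Orbits

variable {𝕜 : Type*} [RCLike 𝕜] {m : ℕ} {A : TestFamily 𝕜 m}

/-- The filter on `𝒜_0` of the sets that, for some `q` and every `φ ∈ 𝒜_q`, contain `φ_ε` for all
small `ε`. -/
def TestFamily.orbitFilter (A : TestFamily 𝕜 m) : Filter A.Idx where
  sets := {s | ∃ q : ℕ, ∀ φ : A.Idx, φ.1 ∈ A.sets q → ∃ η : ℝ, 0 < η ∧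
    ∀ (ε : ℝ) (hε : 0 < ε), ε < η → A.scale ε hε φ ∈ s}
  univ_sets := ⟨0, fun _ _ => ⟨1, one_pos, fun _ _ _ => trivial⟩⟩
  sets_of_superset := by
    rintro s t ⟨q, hq⟩ hst
    refine ⟨q, fun φ hφ => ?_⟩
    obtain ⟨η, h0, h⟩ := hq φ hφ
    exact ⟨η, h0, fun ε hε hlt => hst (h ε hε hlt)⟩
  inter_sets := by
    rintro s t ⟨q, hq⟩ ⟨p, hp⟩
    refine ⟨max q p, fun φ hφ => ?_⟩
    obtain ⟨η, h0, h⟩ := hq φ (A.anti (le_max_left q p) hφ)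
    obtain ⟨θ, k0, k⟩ := hp φ (A.anti (le_max_right q p) hφ)
    exact ⟨min η θ, lt_min h0 k0, fun ε hε hlt =>
      ⟨h ε hε (hlt.trans_le (min_le_left _ _)), k ε hε (hlt.trans_le (min_le_right _ _))⟩⟩

theorem TestFamily.eventually_orbitFilter {p : A.Idx → Prop} :
    (∀ᶠ φ in A.orbitFilter, p φ) ↔ ∃ q : ℕ, ∀ φ : A.Idx, φ.1 ∈ A.sets q → ∃ η : ℝ, 0 < η ∧
      ∀ (ε : ℝ) (hε : 0 < ε), ε < η → p (A.scale ε hε φ) := Iff.rfl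

theorem TestFamily.suppDiam_scale {ε : ℝ} (hε : 0 < ε) (φ : A.Idx) :
    suppDiam (A.scale ε hε φ).1 = ε * suppDiam φ.1 := suppDiam_scaleFun hε φ.1

/-- Negligibility only concerns `φ ∈ 𝒜_q` with `q ≥ N`, so the index supplied by the filter can
serve as `N`. Since the function vanishes there, any gauge will do. -/
theorem isNegligible_of_eventually_orbitFilter {a : A.Idx → ℝ}
    (h : ∀ᶠ φ in A.orbitFilter, a φ = 0) : IsNegligible A a := by
  obtain ⟨N, h⟩ := TestFamily.eventually_orbitFilter.1 h
  refine ⟨N, _, isGauge_cast, fun q hq φ hφ => ?_⟩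
  obtain ⟨η, h0, h⟩ := h φ (A.anti hq hφ)
  refine ⟨1, one_pos, min η 1, lt_min h0 one_pos, min_le_right _ _, fun ε hε hlt => ?_⟩
  rw [h ε hε (hlt.trans_le (min_le_left _ _)), abs_zero]
  positivity

/-- The positive part of `b - a` is nonnegative everywhere and differs from `b - a` only off an
eventual set, so it represents the same class. Unlike in `GenReal.mk_le_mk`, orbits of `φ` outside
some `𝒜_q` are ignored. -/
theorem GenReal.mk_le_mk_of_eventually {a b : modReal A}
    (h : ∀ᶠ φ in A.orbitFilter, a.1 φ ≤ b.1 φ) : GenReal.mk A a ≤ GenReal.mk A b := by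
  have hm : (fun φ => max (b.1 φ - a.1 φ) 0) ∈ modReal A := by
    refine mem_modReal.2 (IsModerate.mono (b := (b - a).1) (b - a).2 fun φ => ?_)
    rw [abs_of_nonneg (le_max_right _ _)]
    exact max_le (le_abs_self _) (abs_nonneg _)
  refine ⟨⟨_, hm⟩, fun φ => le_max_right _ _, ?_⟩
  rw [← map_sub, GenReal.mk_eq_mk]
  refine isNegligible_of_eventually_orbitFilter (h.mono fun φ hφ => ?_)
  change max (b.1 φ - a.1 φ) 0 - (b.1 φ - a.1 φ) = 0
  rw [max_eq_left (by linarith), sub_self]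

/-- A negligible function is eventually smaller than every power of `i(φ)`. -/
theorem IsNegligible.eventually_abs_le (hpos : ∀ φ : A.Idx, 0 < suppDiam φ.1)
    {a : A.Idx → ℝ} (ha : IsNegligible A a) (r : ℕ) :
    ∀ᶠ φ in A.orbitFilter, |a φ| ≤ suppDiam φ.1 ^ r := by
  obtain ⟨N, γ, hγ, ha⟩ := ha
  -- One power of `ε` more than `r` is requested: it absorbs both the constant `c` and the factor
  -- `i(φ)^r` in `i(φ_ε)^r = ε^r i(φ)^r`.
  obtain ⟨q, hq, hNq⟩ := ((tendsto_atTop.1 hγ.2.2 (r + 1 + N)).and (eventually_ge_atTop N)).exists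
  refine TestFamily.eventually_orbitFilter.2 ⟨q, fun φ hφ => ?_⟩
  obtain ⟨c, hc, η, h0, h1, ha⟩ := ha q hNq φ hφ
  have hd : 0 < suppDiam φ.1 ^ r := pow_pos (hpos φ) r
  refine ⟨min η (suppDiam φ.1 ^ r / c), lt_min h0 (div_pos hd hc), fun ε hε hlt => ?_⟩
  have hεη := hlt.trans_le (min_le_left _ _)
  have hεc := hlt.trans_le (min_le_right _ _)
  rw [lt_div_iff₀ hc] at hεc
  rw [TestFamily.suppDiam_scale, mul_pow]
  calc |a (A.scale ε hε φ)| ≤ c * ε ^ (γ q - N) := ha ε hε hεη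
    _ ≤ c * ε ^ ((r + 1 : ℕ) : ℝ) := by
        refine mul_le_mul_of_nonneg_left
          (Real.rpow_le_rpow_of_exponent_ge hε (hεη.le.trans h1) ?_) hc.le
        push_cast
        linarith
    _ = ε ^ r * (ε * c) := by rw [Real.rpow_natCast]; ring
    _ ≤ ε ^ r * suppDiam φ.1 ^ r := by gcongr

/-- A representative of a generalized number below `α_r^•` is eventually below `2 i(φ)^r`. -/
theorem GenReal.eventually_le_of_mk_le_alphaGen (hpos : ∀ φ : A.Idx, 0 < suppDiam φ.1)
    {a : modReal A} {r : ℕ}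
    (h : GenReal.mk A a ≤ alphaGen A r) :
    ∀ᶠ φ in A.orbitFilter, a.1 φ ≤ 2 * suppDiam φ.1 ^ r := by
  obtain ⟨b, hb, hba⟩ := h
  rw [alphaGen, ← map_sub, GenReal.mk_eq_mk] at hba
  -- The nonnegative `b` equals `i(φ)^r - a` up to a negligible error, itself eventually at most
  -- `i(φ)^r`; hence the factor `2`.
  filter_upwards [IsNegligible.eventually_abs_le hpos hba r] with φ hφ
  have h1 : |b.1 φ - (suppDiam φ.1 ^ r - a.1 φ)| ≤ suppDiam φ.1 ^ r := hφ
  have h2 := hb φ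
  rw [abs_le] at h1
  linarith [h1.1, h1.2]

theorem eventually_mul_suppDiam_le (hpos : ∀ φ : A.Idx, 0 < suppDiam φ.1) (c : ℝ) :
    ∀ᶠ φ in A.orbitFilter, c * suppDiam φ.1 ≤ 1 := by
  refine TestFamily.eventually_orbitFilter.2 ⟨0, fun φ _ => ?_⟩
  have := hpos φ
  -- `|c| + 1` keeps the denominator positive whatever the sign of `c`.
  refine ⟨1 / ((|c| + 1) * suppDiam φ.1), by positivity, fun ε hε hlt => ?_⟩
  rw [lt_div_iff₀ (by positivity)] at hlt
  rw [TestFamily.suppDiam_scale]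
  have : c * (ε * suppDiam φ.1) ≤ (|c| + 1) * (ε * suppDiam φ.1) := by
    gcongr
    linarith [le_abs_self c]
  linarith

end Orbits

/-! ### Finite sums of smooth functions and a geometric estimate -/

section Sums

variable {𝕜 : Type*} [RCLike 𝕜] {m : ℕ} {Ω K : Set (E m)}

theorem contDiffOn_sum_apply {ι : Type*} (s : Finset ι) {g : ι → E m → 𝕜}
    (hg : ∀ i ∈ s, ContDiffOn ℝ ∞ (g i) Ω) : ContDiffOn ℝ ∞ (∑ i ∈ s, g i) Ω := by
  have : (∑ i ∈ s, g i) = fun x => ∑ i ∈ s, g i x := by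
    funext x
    rw [Finset.sum_apply]
  rw [this]
  exact ContDiffOn.sum hg

theorem supNorm_multiDeriv_sum_le {ι : Type*} (σ : Fin m → ℕ) (hΩ : IsOpen Ω) (hK : IsCompact K)
    (hKΩ : K ⊆ Ω) (s : Finset ι) {g : ι → E m → 𝕜} (hg : ∀ i, ContDiffOn ℝ ∞ (g i) Ω) :
    supNorm K (multiDeriv σ (∑ i ∈ s, g i)) ≤ ∑ i ∈ s, supNorm K (multiDeriv σ (g i)) := by
  classical
  induction s using Finset.induction_on with
  | empty => simp [supNorm_multiDeriv_zero]
  | insert i s hi ih =>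
    rw [Finset.sum_insert hi, Finset.sum_insert hi]
    exact (supNorm_multiDeriv_add_le σ hΩ hK hKΩ (hg i)
      (contDiffOn_sum_apply s fun j _ => hg j)).trans (add_le_add le_rfl ih)

theorem supNorm_mono {f : E m → 𝕜} {L : Set (E m)} (hL : IsCompact L) (hf : ContinuousOn f L)
    (hKL : K ⊆ L) : supNorm K f ≤ supNorm L f :=
  supNorm_le (supNorm_nonneg _ _) fun _ hx => le_supNorm hL hf (hKL hx)

/-- For `3 x ≤ 1` one has `2 x^{n+1} ≤ x^n - x^{n+1}`, which telescopes. The sum thus costs one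
power of `x` and no constant. -/
theorem sum_two_mul_pow_succ_le {x : ℝ} (h0 : 0 ≤ x) (h1 : 4 * x ≤ 1) (k : ℕ) (s : Finset ℕ)
    (hs : ∀ n ∈ s, k ≤ n) : ∑ n ∈ s, 2 * x ^ (n + 1) ≤ x ^ k := by
  have key : ∀ d, ∑ n ∈ Finset.Ico k (k + d), 2 * x ^ (n + 1) ≤ x ^ k - x ^ (k + d) := by
    intro d
    induction d with
    | zero => simp
    | succ d ih =>
      rw [← add_assoc, Finset.sum_Ico_succ_top (Nat.le_add_right k d), pow_succ]
      nlinarith [pow_nonneg h0 (k + d)]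
  have hsub : s ⊆ Finset.Ico k (k + (s.sup id + 1)) := fun n hn => by
    have : n ≤ s.sup id := Finset.le_sup (f := id) hn
    exact Finset.mem_Ico.2 ⟨hs n hn, by omega⟩
  calc ∑ n ∈ s, 2 * x ^ (n + 1) ≤ ∑ n ∈ Finset.Ico k (k + (s.sup id + 1)), 2 * x ^ (n + 1) :=
        Finset.sum_le_sum_of_subset_of_nonneg hsub fun _ _ _ => by positivity
    _ ≤ _ := (key _).trans (sub_le_self _ (by positivity))

end Sums

/-! ### Countable basis at `0` and reduction to sequences -/

section Completeness

variable {𝕜 : Type*} [RCLike 𝕜] {m : ℕ} {Ω : TopologicalSpace.Opens (E m)} {A : TestFamily 𝕜 m}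
  {e : Exhaustion Ω}

theorem basicNhd_mono {l k : ℕ} (hlk : l ≤ k) {σ τ : Fin m → ℕ} (hστ : σ ≤ τ) {r s : ℕ}
    (hrs : r ≤ s) : basicNhd A e k τ s ⊆ basicNhd A e l σ r := fun f hf κ hκ =>
  GenReal.le_trans (normGen_mono e hlk κ f)
    (GenReal.le_trans (hf κ (hκ.trans hστ)) (alphaGen_anti hrs))

theorem exists_basicNhd_diag_subset (l : ℕ) (σ : Fin m → ℕ) (r : ℕ) :
    ∃ k₀, 1 ≤ k₀ ∧ ∀ k, k₀ ≤ k → basicNhd A e k (fun _ => k) k ⊆ basicNhd A e l σ r :=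
  -- The sum of the entries of `σ` bounds each of them, so one integer dominates `l`, `σ` and `r`.
  ⟨l + ∑ i, σ i + r + 1, by omega, fun k hk => basicNhd_mono (by omega) (fun i => by
    have := Finset.single_le_sum (f := σ) (fun _ _ => Nat.zero_le _) (Finset.mem_univ i)
    dsimp only
    omega) (by omega)⟩

theorem hasBasis_nhds_zero : (@nhds _ (topology A e) 0).HasBasis (fun k : ℕ => 1 ≤ k)
    fun k => basicNhd A e k (fun _ => k) k := by
  let _ : TopologicalSpace (GenFun A Ω) := topology A e
  refine (basis A e).nhds_zero_hasBasis.to_hasBasis ?_ ?_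
  · rintro _ ⟨l, σ, r, hr, rfl⟩
    obtain ⟨k, hk, h⟩ := exists_basicNhd_diag_subset (A := A) (e := e) l σ r
    exact ⟨k, hk, h k le_rfl⟩
  · exact fun k hk => ⟨_, ⟨k, _, k, hk, rfl⟩, subset_rfl⟩

/-- A countably generated uniformity is complete once sequences with prescribed rate of increments
converge. The exponent `n + 1` at level `n` pays for the power lost in the geometric sum. The
conclusion is asked only for large `k`, which the case `m = 0` needs. -/
theorem isCompleteGenFun_of_sequences
    (h : ∀ f : ℕ → GenFun A Ω, (∀ n, f (n + 1) - f n ∈ basicNhd A e n (fun _ => n) (n + 1)) →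
      ∃ g, ∀ᶠ k in atTop, f k - g ∈ basicNhd A e k (fun _ => k) k) :
    IsCompleteGenFun A e := by
  let _ : TopologicalSpace (GenFun A Ω) := topology A e
  have : IsTopologicalAddGroup (GenFun A Ω) := isTopologicalAddGroup A e
  let _ : UniformSpace (GenFun A Ω) := IsTopologicalAddGroup.rightUniformSpace (GenFun A Ω)
  have hU : uniformity (GenFun A Ω) = comap (fun p => p.2 + -p.1) (nhds 0) := rfl
  have : (nhds (0 : GenFun A Ω)).IsCountablyGenerated := hasBasis_nhds_zero.isCountablyGenerated
  have : (uniformity (GenFun A Ω)).IsCountablyGenerated := by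
    rw [hU]
    infer_instance
  change CompleteSpace (GenFun A Ω)
  refine UniformSpace.complete_of_convergent_controlled_sequences
    (fun n => (fun p : GenFun A Ω × GenFun A Ω => p.2 + -p.1) ⁻¹'
      basicNhd A e n (fun _ => n) (n + 1)) (fun n => ?_) fun f hf => ?_
  · rw [hU]
    exact preimage_mem_comap ((basis A e).mem_nhds_zero ⟨n, _, n + 1, by omega, rfl⟩)
  · obtain ⟨g, hg⟩ := h f fun n => by
      have := hf n n (n + 1) le_rfl (Nat.le_succ n)
      rw [sub_eq_add_neg]
      exact this
    refine ⟨g, ?_⟩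
    rw [← tendsto_sub_nhds_zero_iff]
    refine hasBasis_nhds_zero.tendsto_right_iff.2 fun k _ => ?_
    filter_upwards [eventually_ge_atTop k, hg] with n hn hgn
    -- The error at index `n` lies in the neighbourhood of level `n`, which is contained in the
    -- fixed one of level `k`.
    exact basicNhd_mono hn (fun _ => hn) hn hgn

end Completeness

/-! ### Construction of the limit when every support has positive diameter -/

section Gluing

variable {𝕜 : Type*} [RCLike 𝕜] {m : ℕ} {Ω : TopologicalSpace.Opens (E m)} {A : TestFamily 𝕜 m}

theorem Exhaustion.exists_subset (e : Exhaustion Ω) {K : Set (E m)} (hK : IsCompact K)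
    (hKΩ : K ⊆ Ω) : ∃ l, K ⊆ e.sets l :=
  hK.elim_directed_cover e.sets e.isOpen (by rwa [e.iUnion_eq]) e.mono.directed_le

open Classical in
/-- The indices `n < 1 / i(φ)` for which the increment `v_{n+1}(φ, ·) - v_n(φ, ·)` and its
derivatives are bounded by `2 i(φ)^{n+1}` on the closure of `Ω_n`. -/
def smallIncrements (e : Exhaustion Ω) (v : ℕ → modFun A Ω) (φ : A.Idx) : Finset ℕ :=
  (Finset.range ⌈(suppDiam φ.1)⁻¹⌉₊).filter fun n => 4 * suppDiam φ.1 ≤ 1 ∧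
    ∀ κ ∈ Set.Iic fun _ : Fin m => n,
      supNorm (closure (e.sets n)) (multiDeriv κ ((v (n + 1) - v n).1 φ))
        ≤ 2 * suppDiam φ.1 ^ (n + 1)

theorem mem_smallIncrements {e : Exhaustion Ω} {v : ℕ → modFun A Ω} {φ : A.Idx} {n : ℕ} :
    n ∈ smallIncrements e v φ ↔ n < ⌈(suppDiam φ.1)⁻¹⌉₊ ∧ 4 * suppDiam φ.1 ≤ 1 ∧
      ∀ κ ∈ Set.Iic fun _ : Fin m => n,
        supNorm (closure (e.sets n)) (multiDeriv κ ((v (n + 1) - v n).1 φ))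
          ≤ 2 * suppDiam φ.1 ^ (n + 1) := by
  classical
  rw [smallIncrements, Finset.mem_filter, Finset.mem_range]

/-- The sum of `v_0(φ, ·)` and of the small increments of the sequence `v`. -/
def glue (e : Exhaustion Ω) (v : ℕ → modFun A Ω) (φ : A.Idx) : E m → 𝕜 :=
  (v 0).1 φ + ∑ n ∈ smallIncrements e v φ, (v (n + 1) - v n).1 φ

variable (e : Exhaustion Ω) (v : ℕ → modFun A Ω)

/-- No exceptional `φ` occurs, because the bounds are built into the index set. For `n ≥ k` the
bound on the closure of `Ω_n` for orders up to `(n,…,n)` covers the closure of `Ω_k` and the order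
`κ`. -/
theorem supNorm_tail_le (k : ℕ) (κ : Fin m → ℕ) (hκ : κ ≤ fun _ => k) (φ : A.Idx) :
    supNorm (closure (e.sets k)) (multiDeriv κ
      (∑ n ∈ (smallIncrements e v φ).filter (k ≤ ·), (v (n + 1) - v n).1 φ))
      ≤ suppDiam φ.1 ^ k := by
  have h0 : 0 ≤ suppDiam φ.1 := Metric.diam_nonneg
  -- The inequality `4 i(φ) ≤ 1` needed for the geometric sum is only available from a member of the
  -- index set.
  rcases ((smallIncrements e v φ).filter (k ≤ ·)).eq_empty_or_nonempty with hs | ⟨n₀, hn₀⟩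
  · rw [hs, Finset.sum_empty, supNorm_multiDeriv_zero]
    positivity
  have h1 : 4 * suppDiam φ.1 ≤ 1 :=
    (mem_smallIncrements.1 (Finset.mem_filter.1 hn₀).1).2.1
  refine (supNorm_multiDeriv_sum_le κ Ω.isOpen (e.isCompact_closure k) (e.closure_subset k) _
    fun n => (v (n + 1) - v n).2.1 φ).trans (le_trans (Finset.sum_le_sum fun n hn => ?_)
      (sum_two_mul_pow_succ_le h0 h1 k _ fun n hn => (Finset.mem_filter.1 hn).2))
  obtain ⟨hn, hkn⟩ := Finset.mem_filter.1 hn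
  exact (supNorm_mono (e.isCompact_closure n) (multiDeriv_continuousOn κ Ω.isOpen
    (e.closure_subset n) ((v (n + 1) - v n).2.1 φ)) (closure_mono (e.mono hkn))).trans
    ((mem_smallIncrements.1 hn).2.2 κ (hκ.trans fun _ => hkn))

theorem contDiffOn_glue (φ : A.Idx) : ContDiffOn ℝ ∞ (glue e v φ) Ω :=
  ((v 0).2.1 φ).add (contDiffOn_sum_apply _ fun n _ => (v (n + 1) - v n).2.1 φ)

theorem isModerate_supNorm_glue {K : Set (E m)} (hK : IsCompact K) (hKΩ : K ⊆ Ω)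
    (σ : Fin m → ℕ) : IsModerate A fun φ => supNorm K (multiDeriv σ (glue e v φ)) := by
  obtain ⟨l, hl⟩ := e.exists_subset hK hKΩ
  -- This level contains `K` and dominates `σ` at once, so the tail estimate applies from `k` on.
  set k := l + ∑ i, σ i with hk
  have hKk : K ⊆ closure (e.sets k) := hl.trans ((e.mono (by omega)).trans subset_closure)
  have hσk : σ ≤ fun _ => k := fun i => by
    have := Finset.single_le_sum (f := σ) (fun _ _ => Nat.zero_le _) (Finset.mem_univ i)
    dsimp only
    omega
  -- The indices below `k` retained at `φ` vary with `φ`; summing the norms over all `n < k` gives a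
  -- majorant whose index set does not.
  have hsum : IsModerate A (∑ n ∈ Finset.range k,
      fun φ => supNorm K (multiDeriv σ ((v (n + 1) - v n).1 φ))) :=
    sum_mem (S := modReal A) fun n _ => (v (n + 1) - v n).2.2 K hK hKΩ σ
  refine IsModerate.mono (IsModerate.add (IsModerate.add ((v 0).2.2 K hK hKΩ σ) hsum)
    (isModerate_suppDiam_pow k)) fun φ => ?_
  rw [abs_of_nonneg (supNorm_nonneg _ _)]
  refine le_trans ?_ (le_abs_self _)
  have hD : ∀ n, ContDiffOn ℝ ∞ ((v (n + 1) - v n).1 φ) Ω := fun n => (v (n + 1) - v n).2.1 φ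
  have hsplit : glue e v φ = ((v 0).1 φ
      + ∑ n ∈ (smallIncrements e v φ).filter (¬ k ≤ ·), (v (n + 1) - v n).1 φ)
      + ∑ n ∈ (smallIncrements e v φ).filter (k ≤ ·), (v (n + 1) - v n).1 φ := by
    rw [glue, ← Finset.sum_filter_add_sum_filter_not (smallIncrements e v φ) (k ≤ ·)]
    abel
  have htail := contDiffOn_sum_apply ((smallIncrements e v φ).filter (k ≤ ·)) fun n _ => hD n
  have hhead := contDiffOn_sum_apply ((smallIncrements e v φ).filter (¬ k ≤ ·)) fun n _ => hD n
  rw [hsplit]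
  refine (supNorm_multiDeriv_add_le σ Ω.isOpen hK hKΩ (((v 0).2.1 φ).add hhead) htail).trans
    (add_le_add ((supNorm_multiDeriv_add_le σ Ω.isOpen hK hKΩ ((v 0).2.1 φ) hhead).trans
      (add_le_add le_rfl ?_)) ?_)
  · rw [Finset.sum_apply]
    refine (supNorm_multiDeriv_sum_le σ Ω.isOpen hK hKΩ _ hD).trans
      (Finset.sum_le_sum_of_subset_of_nonneg (fun n hn => ?_) fun _ _ _ => supNorm_nonneg _ _)
    exact Finset.mem_range.2 (not_le.1 (Finset.mem_filter.1 hn).2)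
  · exact (supNorm_mono (e.isCompact_closure k) (multiDeriv_continuousOn σ Ω.isOpen
      (e.closure_subset k) htail) hKk).trans (supNorm_tail_le e v k σ hσk φ)

/-- `glue e v` as an element of `ℰ_M[Ω]`. -/
def glueFun : modFun A Ω :=
  ⟨glue e v, contDiffOn_glue e v, fun _ hK hKΩ σ => isModerate_supNorm_glue e v hK hKΩ σ⟩

variable {e v}

/-- Each condition defining the index set holds eventually for this fixed `n`; nothing is claimed
uniformly in `n`. -/
theorem eventually_mem_smallIncrements (hpos : ∀ φ : A.Idx, 0 < suppDiam φ.1) {n : ℕ}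
    (hv : GenFun.mk A Ω (v (n + 1)) - GenFun.mk A Ω (v n)
      ∈ basicNhd A e n (fun _ => n) (n + 1)) :
    ∀ᶠ φ in A.orbitFilter, n ∈ smallIncrements e v φ := by
  have hsmall : ∀ᶠ φ in A.orbitFilter, ∀ κ ∈ Set.Iic fun _ : Fin m => n,
      supNorm (closure (e.sets n)) (multiDeriv κ ((v (n + 1) - v n).1 φ))
        ≤ 2 * suppDiam φ.1 ^ (n + 1) := by
    -- Only finitely many `κ` lie below `(n,…,n)`, so their eventual bounds can be intersected.
    refine (eventually_all_finite (Set.finite_Iic _)).2 fun κ hκ => ?_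
    have h := hv κ hκ
    rw [← map_sub, normGen_mk] at h
    exact GenReal.eventually_le_of_mk_le_alphaGen hpos h
  filter_upwards [hsmall, eventually_mul_suppDiam_le hpos 4,
    eventually_mul_suppDiam_le hpos (n + 1)] with φ h1 h2 h3
  -- The strict bound `n < 1 / i(φ)` comes from `(n + 1) i(φ) ≤ 1` and `i(φ) > 0`.
  refine mem_smallIncrements.2 ⟨Nat.lt_ceil.2 ?_, h2, h1⟩
  rw [← one_div, lt_div_iff₀ (hpos φ)]
  linarith [hpos φ]

/-- Only the finitely many `n < k` must be retained for the head to telescope, and this holds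
eventually; the order in `ℝ̄` does not see other `φ`. -/
theorem mk_sub_mk_glueFun_mem (hpos : ∀ φ : A.Idx, 0 < suppDiam φ.1)
    (hv : ∀ n, GenFun.mk A Ω (v (n + 1)) - GenFun.mk A Ω (v n)
      ∈ basicNhd A e n (fun _ => n) (n + 1)) (k : ℕ) :
    GenFun.mk A Ω (v k) - GenFun.mk A Ω (glueFun e v) ∈ basicNhd A e k (fun _ => k) k := by
  intro κ hκ
  rw [← neg_sub, normGen_neg, ← map_sub, normGen_mk]
  refine GenReal.mk_le_mk_of_eventually ?_
  have hall : ∀ᶠ φ in A.orbitFilter, ∀ n ∈ Finset.range k, n ∈ smallIncrements e v φ :=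
    (eventually_all_finset _).2 fun n _ => eventually_mem_smallIncrements hpos (hv n)
  filter_upwards [hall] with φ hφ
  have hhead : (smallIncrements e v φ).filter (¬ k ≤ ·) = Finset.range k := by
    ext n
    rw [Finset.mem_filter, not_le, ← Finset.mem_range]
    exact ⟨fun h => h.2, fun h => ⟨hφ n h, h⟩⟩
  have htele : ∑ n ∈ Finset.range k, (v (n + 1) - v n).1 φ = (v k).1 φ - (v 0).1 φ :=
    Finset.sum_range_sub (fun n => (v n).1 φ) k
  have hdiff : (glueFun e v - v k).1 φ
      = ∑ n ∈ (smallIncrements e v φ).filter (k ≤ ·), (v (n + 1) - v n).1 φ := by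
    change glue e v φ - (v k).1 φ = _
    rw [glue, ← Finset.sum_filter_add_sum_filter_not (smallIncrements e v φ) (k ≤ ·), hhead, htele]
    abel
  change supNorm (closure (e.sets k)) (multiDeriv κ ((glueFun e v - v k).1 φ)) ≤ suppDiam φ.1 ^ k
  rw [hdiff]
  exact supNorm_tail_le e v k κ hκ φ

theorem isCompleteGenFun_of_suppDiam_pos (e : Exhaustion Ω)
    (hpos : ∀ φ : A.Idx, 0 < suppDiam φ.1) : IsCompleteGenFun A e := by
  refine isCompleteGenFun_of_sequences fun f hf => ?_
  choose v hv using fun n => GenFun.mk_surjective A Ω (f n)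
  obtain rfl : f = fun n => GenFun.mk A Ω (v n) := funext fun n => (hv n).symm
  exact ⟨_, Eventually.of_forall (mk_sub_mk_glueFun_mem hpos hf)⟩

end Gluing

/-- A support of diameter `0` has at most one point, hence is a null set in dimension `m ≥ 1`, and
the integral would vanish. -/
theorem suppDiam_pos {𝕜 : Type*} [RCLike 𝕜] {m : ℕ} [NeZero m] {φ : E m → 𝕜}
    (hc : HasCompactSupport φ) (hφ : ∫ x, φ x = 1) : 0 < suppDiam φ := by
  refine Metric.diam_pos ?_ hc.isCompact.isBounded
  by_contra h
  rw [Set.not_nontrivial_iff] at h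
  -- Nontriviality of the space is what makes Lebesgue measure free of atoms.
  have : Nontrivial (E m) := by
    have : Nonempty (Fin m) := ⟨0⟩
    infer_instance
  have h0 : MeasureTheory.volume (tsupport φ) = 0 := h.measure_zero _
  have h1 : ∫ x, φ x = 0 := by
    refine MeasureTheory.integral_eq_zero_of_ae ?_
    refine MeasureTheory.measure_mono_null (fun x hx => subset_tsupport φ hx) h0
  rw [h1] at hφ
  exact zero_ne_one hφ

/-! ### The degenerate case `m = 0` -/

section Subsingleton

variable {𝕜 : Type*} [RCLike 𝕜] {Ω : TopologicalSpace.Opens (E 0)} {A : TestFamily 𝕜 0}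

theorem alphaGen_eq_of_subsingleton {r s : ℕ} (hr : 1 ≤ r) (hs : 1 ≤ s) :
    alphaGen A r = alphaGen A s := by
  unfold alphaGen
  congr 1
  apply Subtype.ext
  funext φ
  have : suppDiam φ.1 = 0 := Metric.diam_subsingleton Set.subsingleton_of_subsingleton
  change suppDiam φ.1 ^ r = suppDiam φ.1 ^ s
  rw [this, zero_pow (by omega), zero_pow (by omega)]

/-- There is only one multi-index, all `α_r^•` with `r ≥ 1` coincide, and `Ω_n` is already all of
`Ω`. So this neighbourhood is contained in every other one. -/
theorem basicNhd_subset_of_subsingleton (e : Exhaustion Ω) {n : ℕ}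
    (hn : (Ω : Set (E 0)) ⊆ e.sets n) (k : ℕ) (σ τ : Fin 0 → ℕ) {r s : ℕ} (hr : 1 ≤ r)
    (hs : 1 ≤ s) : basicNhd A e n σ r ⊆ basicNhd A e k τ s := by
  intro f hf κ _
  have hκ := hf κ fun i => i.elim0
  rw [alphaGen_eq_of_subsingleton hr hs] at hκ
  refine GenReal.le_trans ?_ hκ
  obtain ⟨u, rfl⟩ := GenFun.mk_surjective A Ω f
  rw [normGen_mk, normGen_mk]
  exact GenReal.mk_le_mk' fun φ => supNorm_mono (e.isCompact_closure n)
    (multiDeriv_continuousOn κ Ω.isOpen (e.closure_subset n) (u.2.1 φ))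
    (closure_mono ((subset_closure.trans (e.closure_subset k)).trans hn))

theorem isCompleteGenFun_of_subsingleton (e : Exhaustion Ω) : IsCompleteGenFun A e := by
  obtain ⟨l, hl⟩ := e.exists_subset (Set.toFinite (Ω : Set (E 0))).isCompact subset_rfl
  have hsub : ∀ n, l ≤ n → (Ω : Set (E 0)) ⊆ e.sets n := fun n hn => hl.trans (e.mono hn)
  refine isCompleteGenFun_of_sequences fun f hf => ⟨f l, ?_⟩
  -- Besides `l ≤ k` this ensures `k ≥ 1`, since `α_0^•` is excluded from the equality of the
  -- `α_r^•`.
  filter_upwards [eventually_ge_atTop (l + 1)] with k hk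
  suffices h : f k - f l ∈ basicNhd A e l 0 1 from
    basicNhd_subset_of_subsingleton e hl k _ _ le_rfl (by omega) h
  have hlk : l ≤ k := by omega
  clear hk
  induction k, hlk using Nat.le_induction with
  | base =>
    rw [sub_self]
    intro κ _
    rw [normGen_zero]
    exact zero_le_alphaGen 1
  | succ k hk ih =>
    -- Both differences may be placed in the neighbourhood with exponent `2`, whence `α_2^• + α_2^•
    -- ≤ α_1^•` returns the sum to exponent `1`.
    have h1 := basicNhd_subset_of_subsingleton e (hsub k hk) l _ 0 (Nat.le_add_left 1 k)
      one_le_two (hf k)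
    have h2 := basicNhd_subset_of_subsingleton e hl l _ 0 le_rfl one_le_two ih
    intro κ hκ
    rw [← sub_add_sub_cancel (f (k + 1)) (f k) (f l)]
    exact GenReal.le_trans (normGen_add_le e l κ _ _)
      (GenReal.le_trans (GenReal.add_le_add (h1 κ hκ) (h2 κ hκ)) (alphaGen_succ_add_le 1))

end Subsingleton

end Colombeau

end

theorem corollary1p13 (𝕜 : Type*) [RCLike 𝕜] (m : ℕ)
    (Ω : TopologicalSpace.Opens (EuclideanSpace ℝ (Fin m))) (e : Colombeau.Exhaustion Ω) :
    Colombeau.IsCompleteGenFun (Colombeau.momentFamily 𝕜 m) e ∧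
      Colombeau.IsCompleteGenFun (Colombeau.radialFamily 𝕜 m) e := by
  -- For `m = 0` every support has diameter `0`, so the positivity required by the gluing fails.
  rcases m.eq_zero_or_pos with rfl | hm
  · exact ⟨Colombeau.isCompleteGenFun_of_subsingleton e,
      Colombeau.isCompleteGenFun_of_subsingleton e⟩
  · have : NeZero m := ⟨hm.ne'⟩
    exact ⟨Colombeau.isCompleteGenFun_of_suppDiam_pos e fun φ =>
        Colombeau.suppDiam_pos φ.2.2.1 φ.2.2.2.1,
      Colombeau.isCompleteGenFun_of_suppDiam_pos e fun φ =>
        Colombeau.suppDiam_pos φ.2.2.1 φ.2.2.2.2.2.1⟩
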